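/- Let $p>1$, $q\ge p-1$. For $m>q$, call $u:[0,\infty)\to\mathbb R$ a positive ground state if $u>0$ on $[0,\infty)$, $u$ and $|u'|^{p-2}u'$ are differentiable on $(0,\infty)$ and $$(|u'|^{p-2}u')'+u^m=u^q\ \text{ for } 0<r<\infty,\qquad u'(0)=0,\qquad \lim_{r\to\infty}u(r)=0 .$$ Write $B(x;a,b)=\int_0^x t^{a-1}(1-t)^{b-1}\,dt$ for the incomplete Beta function, $\mathcal B(a,b)=B(1;a,b)$, and $$\bar C=\Big(\tfrac{p}{p-1}\Big)^{1/p}(m-q)(m+1)^{\frac{1+q-p}{p(m-q)}}(q+1)^{\frac{p-m-1}{p(m-q)}},\qquad \theta=\frac{p(m-q)}{(m+1)[(p-q-1)+p(q+1)]},$$ $$\ell=\frac{m-q}{(m+1)[(p-1)(q+1)+p]},\qquad \eta_1=(p-1)(m+1)+p,\qquad \eta_2=(p-1)(q+1)+p .$$ **1. Closed form.** For every $m>q$, the function $x\mapsto B\big(x;1-\frac1p,\frac{p-1-q}{p(m-q)}\big)$ is a bijection of $[0,1)$ onto $[0,\infty)$; let $B^{-1}\big(\cdot\,;1-\frac1p,\frac{p-1-q}{p(m-q)}\big)$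 be its inverse. There is exactly one positive ground state $u_{c,m}$, and $$u_{c,m}(r)=\Big(\frac{m+1}{q+1}\Big)^{\frac1{m-q}}\Big(1-B^{-1}\big(\bar C r;1-\tfrac1p,\tfrac{p-1-q}{p(m-q)}\big)\Big)^{\frac1{m-q}},\qquad r\ge 0 .$$ It satisfies $u_{c,m}'(r)<0$ for $r>0$, and the function $x\mapsto u_{c,m}(|x|)$ belongs to $L^{q+1}(\mathbb R)$ and has a weak derivative in $L^p(\mathbb R)$. **2. Best constant.** For every $m>q$, the smallest constant $C_{q,m,p}\ge 0$ such that $$\|v\|_{L^{m+1}(\mathbb R)}\le C_{q,m,p}\,\|v\|_{L^{q+1}(\mathbb R)}^{1-\theta}\,\|v'\|_{L^p(\mathbb R)}^{\theta}$$ for all real-valued $v\in L^{q+1}(\mathbb R)$ with weak derivative $v'\in L^p(\mathbb R)$ exists, and $$C_{q,m,p}=\left(\frac{2^p(p-1)^{1-p}\,\eta_1^{\frac{\eta_1}{m-q}}}{(m-q)^{2p-1}\,\eta_2^{\frac{\eta_2}{m-q}}}\ \mathcal B\Big(\frac{\eta_2}{p(m-q)},\frac{2p-1}{p}\Big)^{p}\right)^{-\ell}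 =\theta^{-\frac{\theta}{p}}(1-\theta)^{\frac{\theta}{p}-\frac1{m+1}}M_c^{-\theta},\quad M_c=\int_{\mathbb R}u_{c,m}(|x|)^{q+1}\,dx .$$ **3. Decay uniform in $m$.** There is $r_*>0$, depending only on $p$ and $q$, such that: * if $q>p-1$, there is $C>0$ depending only on $p,q$ such that for all $m>2q+1$ $$u_{c,m}(r)+r|u_{c,m}'(r)|\le C\,r^{-\frac{p}{q+1-p}}\qquad\text{for } r\ge 2r_*;$$ * if $q=p-1$, there is $C>0$ depending only on $p,q$ such that for all $m>2q+1$ $$u_{c,m}(r)\le e^{-Cr}\qquad\text{for } r\ge 2r_* .$$ -/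

import Mathlib

open MeasureTheory Set Filter Topology

noncomputable section

namespace GNOneDim

/-- The incomplete Beta function `B(x; a, b) = ∫₀ˣ t^(a-1) (1-t)^(b-1) dt`. -/
def incBeta (x a b : ℝ) : ℝ := ∫ t in (0 : ℝ)..x, t ^ (a - 1) * (1 - t) ^ (b - 1)

/-- The complete Beta function `𝓑(a, b) = ∫₀¹ t^(a-1) (1-t)^(b-1) dt`. -/
def completeBeta (a b : ℝ) : ℝ := incBeta 1 a b

/-- The inverse `y ↦ B⁻¹(y; a, b)` of `x ↦ B(x; a, b)`, with values in `[0, 1)`. -/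
def incBetaInv (y a b : ℝ) : ℝ := Function.invFunOn (fun x => incBeta x a b) (Ico 0 1) y

/-- `u`, looked at on `[0, ∞)`, is a positive solution of
`(|u'|^(p-2) u')' + u^m = u^q` on `0 < r < ∞`, `u'(0) = 0`, `u(r) → 0` as `r → ∞`
(the radial equation in dimension one; only the values of `u` on `[0, ∞)` matter). -/
structure IsPositiveSolution (p q m : ℝ) (u : ℝ → ℝ) : Prop where
  pos : ∀ r, 0 ≤ r → 0 < u r
  differentiableAt : ∀ r, 0 < r → DifferentiableAt ℝ u r
  differentiableAt_flux : ∀ r, 0 < r →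
    DifferentiableAt ℝ (fun s => |deriv u s| ^ (p - 2) * deriv u s) r
  equation : ∀ r, 0 < r →
    deriv (fun s => |deriv u s| ^ (p - 2) * deriv u s) r + u r ^ m = u r ^ q
  deriv_zero : HasDerivWithinAt u 0 (Ici 0) 0
  tendsto_zero : Tendsto u atTop (𝓝 0)

/-- `g` is the weak (distributional) derivative of `v` on the real line. -/
def HasWeakDeriv (v g : ℝ → ℝ) : Prop :=
  LocallyIntegrable v volume ∧ LocallyIntegrable g volume ∧
    ∀ φ : ℝ → ℝ, ContDiff ℝ (⊤ : ℕ∞) φ → HasCompactSupport φ →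
      ∫ x, v x * deriv φ x = -∫ x, g x * φ x

/-- `v ∈ L^(q+1)(ℝ)` and `g ∈ L^p(ℝ)` is its weak derivative. -/
def MemX (p q : ℝ) (v g : ℝ → ℝ) : Prop :=
  MemLp v (ENNReal.ofReal (q + 1)) volume ∧ MemLp g (ENNReal.ofReal p) volume ∧ HasWeakDeriv v g

/-- The interpolation exponent in dimension one. -/
def theta (p q m : ℝ) : ℝ := p * (m - q) / ((m + 1) * ((p - q - 1) + p * (q + 1)))

/-- The inequality `‖v‖_{m+1} ≤ K ‖v‖_{q+1}^(1-θ) ‖v'‖_p^θ` holds for all `v ∈ L^(q+1)(ℝ)` with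
`v' ∈ L^p(ℝ)`. The right-hand side is finite, so `v ∈ L^(m+1)(ℝ)` is part of the claim. -/
def GNInequality (p q m K : ℝ) : Prop :=
  ∀ v g : ℝ → ℝ, MemX p q v g →
    eLpNorm v (ENNReal.ofReal (m + 1)) volume ≤
      ENNReal.ofReal K * eLpNorm v (ENNReal.ofReal (q + 1)) volume ^ (1 - theta p q m) *
        eLpNorm g (ENNReal.ofReal p) volume ^ theta p q m

/-- `K` is the smallest nonnegative constant for which the inequality holds. -/
def IsBestConstant (p q m K : ℝ) : Prop := IsLeast {K' : ℝ | 0 ≤ K' ∧ GNInequality p q m K'} K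

/-- The constant `C̄` of the closed form. -/
def Cbar (p q m : ℝ) : ℝ :=
  (p / (p - 1)) ^ (1 / p) * (m - q) * (m + 1) ^ ((1 + q - p) / (p * (m - q))) *
    (q + 1) ^ ((p - m - 1) / (p * (m - q)))

/-- The closed form
`((m+1)/(q+1))^(1/(m-q)) (1 - B⁻¹(C̄ r; 1 - 1/p, (p-1-q)/(p(m-q))))^(1/(m-q))`. -/
def closedForm (p q m r : ℝ) : ℝ :=
  ((m + 1) / (q + 1)) ^ (1 / (m - q)) *
    (1 - incBetaInv (Cbar p q m * r) (1 - 1 / p) ((p - 1 - q) / (p * (m - q)))) ^ (1 / (m - q))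

/-- `η₁ = (p-1)(m+1) + p`. -/
def eta1 (p m : ℝ) : ℝ := (p - 1) * (m + 1) + p

/-- `η₂ = (p-1)(q+1) + p`. -/
def eta2 (p q : ℝ) : ℝ := (p - 1) * (q + 1) + p

/-- `ℓ = (m-q) / ((m+1) ((p-1)(q+1) + p))`. -/
def ell (p q m : ℝ) : ℝ := (m - q) / ((m + 1) * ((p - 1) * (q + 1) + p))

/-- The explicit value of the best constant. -/
def sharpConst (p q m : ℝ) : ℝ :=
  ((2 ^ p * (p - 1) ^ (1 - p) * eta1 p m ^ (eta1 p m / (m - q))) /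
      ((m - q) ^ (2 * p - 1) * eta2 p q ^ (eta2 p q / (m - q))) *
    completeBeta (eta2 p q / (p * (m - q))) ((2 * p - 1) / p) ^ p) ^ (-ell p q m)

/-- The best constant expressed through the mass `M` of the ground state,
`θ^(-θ/p) (1-θ)^(θ/p - 1/(m+1)) M^(-θ)`. -/
def massConst (p q m M : ℝ) : ℝ :=
  theta p q m ^ (-(theta p q m / p)) *
    (1 - theta p q m) ^ (theta p q m / p - 1 / (m + 1)) * M ^ (-theta p q m)

end GNOneDim

end

/-!
Multiplying the equation by `u'` shows that an energy is conserved along a ground state, and the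
conditions at infinity make it vanish. Hence `u` is decreasing, its initial height is forced, and
it solves the first-order equation `|u'|^p = p/(p-1) (u^(q+1)/(q+1) - u^(m+1)/(m+1))`. In the
variable `X = 1 - (u/u(0))^(m-q)` this reads `(B(X))' = C̄`, which is the closed form. Since a
ground state drops below the height `1` after a time bounded in `m`, and from then on
`-u' ≥ c u^((q+1)/p)` with `c` independent of `m > 2q + 1`, the decay is uniform in `m`.

For the sharp inequality, let `M = sup |v|`. The graph of `v` sweeps the heights from `0` to `M`
twice, so Hölder's inequality applied to the product of `|v'|` and
`(M^(m-q) |v|^(q+1) - |v|^(m+1))^((p-1)/p)` bounds a Beta integral in `M` by the three norms;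
eliminating `M` gives the constant. By the first-order equation, every step is an equality for the
ground state.
-/

namespace GNOneDim

section Slopes

variable {f : ℝ → ℝ} {d : ℝ}

lemma eq_zero_of_tendsto_abs_deriv_atTop {l : ℝ} (hf : ∀ᶠ r in atTop, DifferentiableAt ℝ f r)
    (hl : Tendsto f atTop (𝓝 l)) (hd : Tendsto (fun r => |deriv f r|) atTop (𝓝 d)) : d = 0 := by
  obtain ⟨R, hR⟩ := eventually_atTop.1 hf
  have mean_value : ∀ r, R ≤ r → ∃ c ∈ Ioo r (r + 1), deriv f c = f (r + 1) - f r := by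
    intro r hr
    obtain ⟨c, hc, hslope⟩ := exists_deriv_eq_slope f (lt_add_one r)
      (fun x hx => (hR x (hr.trans hx.1)).continuousAt.continuousWithinAt)
      (fun x hx => (hR x (hr.trans hx.1.le)).differentiableWithinAt)
    exact ⟨c, hc, by rw [hslope, add_sub_cancel_left, div_one]⟩
  choose! c hc hslope using mean_value
  have hc_top : Tendsto c atTop atTop :=
    tendsto_atTop_mono' _ ((eventually_ge_atTop R).mono fun r hr => (hc r hr).1.le) tendsto_id
  have hincrement : Tendsto (fun r => |f (r + 1) - f r|) atTop (𝓝 0) := by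
    simpa using ((hl.comp (tendsto_atTop_add_const_right _ 1 tendsto_id)).sub hl).abs
  refine tendsto_nhds_unique ((hd.comp hc_top).congr' ?_) hincrement
  filter_upwards [eventually_ge_atTop R] with r hr
  rw [Function.comp_apply, hslope r hr]

lemma eq_abs_of_tendsto_abs_deriv_nhdsGT {a f' : ℝ}
    (hf : ∀ᶠ r in 𝓝[>] a, DifferentiableAt ℝ f r) (hfa : HasDerivWithinAt f f' (Ici a) a)
    (hd : Tendsto (fun r => |deriv f r|) (𝓝[>] a) (𝓝 d)) : d = |f'| := by
  obtain ⟨b, hab, hb⟩ := mem_nhdsGT_iff_exists_Ioc_subset.1 hf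
  have mean_value : ∀ r ∈ Ioc a b, ∃ c ∈ Ioo a r, deriv f c = slope f a r := by
    intro r hr
    have hcont : ContinuousOn f (Icc a r) := fun x hx => by
      rcases hx.1.eq_or_lt with rfl | hax
      · exact hfa.continuousWithinAt.mono Icc_subset_Ici_self
      · exact (hb ⟨hax, hx.2.trans hr.2⟩).continuousAt.continuousWithinAt
    obtain ⟨c, hc, hslope⟩ := exists_deriv_eq_slope f hr.1 hcont
      fun x hx => (hb ⟨hx.1, hx.2.le.trans hr.2⟩).differentiableWithinAt
    exact ⟨c, hc, by rw [hslope, slope_def_field]⟩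
  choose! c hc hslope using mean_value
  have hnear : ∀ᶠ r in 𝓝[>] a, r ∈ Ioc a b := Ioc_mem_nhdsGT hab
  have hc_lim : Tendsto c (𝓝[>] a) (𝓝[>] a) := by
    refine tendsto_nhdsWithin_iff.2 ⟨?_, hnear.mono fun r hr => (hc r hr).1⟩
    exact tendsto_of_tendsto_of_tendsto_of_le_of_le' tendsto_const_nhds
      (tendsto_id.mono_left nhdsWithin_le_nhds) (hnear.mono fun r hr => (hc r hr).1.le)
      (hnear.mono fun r hr => (hc r hr).2.le)
  have hslope_lim : Tendsto (slope f a) (𝓝[>] a) (𝓝 f') := by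
    simpa using hasDerivWithinAt_iff_tendsto_slope.1 hfa
  refine tendsto_nhds_unique ((hd.comp hc_lim).congr' ?_) hslope_lim.abs
  filter_upwards [hnear] with r hr
  rw [Function.comp_apply, hslope r hr]

end Slopes

section OddPower

/-- The odd power `|d|^(p-2) d`, inverse to the odd power of the conjugate exponent; the equation
of `IsPositiveSolution` is about the derivative of `oddPow p (u')`. -/
noncomputable def oddPow (p d : ℝ) : ℝ := |d| ^ (p - 2) * d

variable {p p' d : ℝ}

lemma abs_oddPow (hp : 1 < p) (d : ℝ) : |oddPow p d| = |d| ^ (p - 1) := by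
  rcases eq_or_ne d 0 with rfl | hd
  · simp [oddPow, Real.zero_rpow (sub_pos.2 hp).ne']
  · rw [oddPow, abs_mul, abs_of_nonneg (Real.rpow_nonneg (abs_nonneg d) _),
      ← Real.rpow_add_one (abs_pos.2 hd).ne']
    ring_nf

lemma abs_oddPow_rpow (h : p.HolderConjugate p') (d : ℝ) : |oddPow p d| ^ p' = |d| ^ p := by
  rw [abs_oddPow h.lt, ← Real.rpow_mul (abs_nonneg d), h.sub_one_mul_conj]

lemma oddPow_oddPow (h : p.HolderConjugate p') (d : ℝ) : oddPow p' (oddPow p d) = d := by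
  rcases eq_or_ne d 0 with rfl | hd
  · simp [oddPow]
  · have hexp : (p - 1) * (p' - 2) + (p - 2) = 0 := by linear_combination h.sub_one_mul_conj
    rw [oddPow, abs_oddPow h.lt, ← Real.rpow_mul (abs_nonneg d), oddPow, ← mul_assoc,
      ← Real.rpow_add (abs_pos.2 hd), hexp, Real.rpow_zero, one_mul]

lemma oddPow_neg_of_pos (hd : 0 < d) : oddPow p (-d) = -d ^ (p - 1) := by
  rw [oddPow, abs_neg, abs_of_pos hd, mul_neg, ← Real.rpow_add_one hd.ne']
  ring_nf

lemma hasDerivAt_abs_oddPow_rpow {w : ℝ → ℝ} {w' r : ℝ} (h : p.HolderConjugate p')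
    (hw : HasDerivAt (fun s => oddPow p (w s)) w' r) :
    HasDerivAt (fun s => |w s| ^ p) (p' * w r * w') r := by
  have := (hasDerivAt_abs_rpow (oddPow p (w r)) h.symm.lt).comp r hw
  refine (this.congr_deriv ?_).congr_of_eventuallyEq (.of_forall fun s => ?_)
  · rw [mul_assoc p', ← oddPow, oddPow_oddPow h]
  · exact (abs_oddPow_rpow h (w s)).symm

end OddPower

section Potential

variable {p q m s : ℝ}

/-- The potential `F` with `F' = s^q - s^m`. -/
noncomputable def potential (q m s : ℝ) : ℝ := s ^ (q + 1) / (q + 1) - s ^ (m + 1) / (m + 1)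

/-- The positive zero of the potential, which is the maximum `u(0)` of the ground state. -/
noncomputable def peak (q m : ℝ) : ℝ := ((m + 1) / (q + 1)) ^ (1 / (m - q))

/-- The variable `X = 1 - (s / u(0))^(m-q)`, in which the ground state is an inverse Beta
function. -/
noncomputable def deficit (q m s : ℝ) : ℝ := 1 - (s / peak q m) ^ (m - q)

/-- The inverse of `deficit`. -/
noncomputable def ofDeficit (q m x : ℝ) : ℝ := peak q m * (1 - x) ^ (1 / (m - q))

/-- The value of `-u'` at height `u = s`, which the energy identity
`|u'|^p = p/(p-1) F(u)` prescribes. -/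
noncomputable def speed (p q m s : ℝ) : ℝ := (p / (p - 1) * potential q m s) ^ (1 / p)

/-- The constant `κ` in `-u' = κ u^((q+1)/p) X^(1/p)`, where `X` is the deficit of `u`. -/
noncomputable def kappa (p q : ℝ) : ℝ := (p / (p - 1) / (q + 1)) ^ (1 / p)

lemma hasDerivAt_potential (hq : q + 1 ≠ 0) (hm : m + 1 ≠ 0) (hs : 0 < s) :
    HasDerivAt (potential q m) (s ^ q - s ^ m) s := by
  have hasDerivAt_term {k : ℝ} (hk : k + 1 ≠ 0) :
      HasDerivAt (fun s => s ^ (k + 1) / (k + 1)) (s ^ k) s := by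
    simpa [mul_div_cancel_left₀ _ hk] using
      (Real.hasDerivAt_rpow_const (p := k + 1) (Or.inl hs.ne')).div_const (k + 1)
  exact (hasDerivAt_term hq).sub (hasDerivAt_term hm)

lemma continuous_potential (hq : 0 ≤ q + 1) (hm : 0 ≤ m + 1) : Continuous (potential q m) :=
  ((Real.continuous_rpow_const hq).div_const _).sub ((Real.continuous_rpow_const hm).div_const _)

lemma potential_zero (hq : q + 1 ≠ 0) (hm : m + 1 ≠ 0) : potential q m 0 = 0 := by
  simp [potential, Real.zero_rpow hq, Real.zero_rpow hm]

lemma one_lt_peak (hq : 0 < q + 1) (hm : q < m) : 1 < peak q m :=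
  Real.one_lt_rpow ((one_lt_div hq).2 (by linarith)) (one_div_pos.2 (sub_pos.2 hm))

lemma peak_pos (hq : 0 < q + 1) (hm : q < m) : 0 < peak q m :=
  one_pos.trans (one_lt_peak hq hm)

lemma peak_rpow (hq : 0 < q + 1) (hm : q < m) : peak q m ^ (m - q) = (m + 1) / (q + 1) := by
  rw [peak, ← Real.rpow_mul (div_nonneg (by linarith) hq.le),
    one_div_mul_cancel (sub_pos.2 hm).ne', Real.rpow_one]

lemma one_sub_deficit : 1 - deficit q m s = (s / peak q m) ^ (m - q) := sub_sub_cancel _ _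

lemma one_sub_deficit_eq (hq : 0 < q + 1) (hm : q < m) (hs : 0 ≤ s) :
    1 - deficit q m s = s ^ (m - q) * ((q + 1) / (m + 1)) := by
  rw [one_sub_deficit, Real.div_rpow hs (peak_pos hq hm).le, peak_rpow hq hm, div_div_eq_mul_div,
    mul_div_assoc]

lemma one_sub_deficit_pos (hq : 0 < q + 1) (hm : q < m) (hs : 0 < s) :
    0 < 1 - deficit q m s := by
  rw [one_sub_deficit]
  exact Real.rpow_pos_of_pos (div_pos hs (peak_pos hq hm)) _

lemma deficit_lt_one (hq : 0 < q + 1) (hm : q < m) (hs : 0 < s) : deficit q m s < 1 :=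
  sub_pos.1 (one_sub_deficit_pos hq hm hs)

lemma deficit_pos (hq : 0 < q + 1) (hm : q < m) (hs : 0 ≤ s) (hlt : s < peak q m) :
    0 < deficit q m s :=
  sub_pos.2 (Real.rpow_lt_one (div_nonneg hs (peak_pos hq hm).le)
    ((div_lt_one (peak_pos hq hm)).2 hlt) (sub_pos.2 hm))

lemma deficit_neg (hq : 0 < q + 1) (hm : q < m) (hs : peak q m < s) : deficit q m s < 0 :=
  sub_neg.2 (Real.one_lt_rpow ((one_lt_div (peak_pos hq hm)).2 hs) (sub_pos.2 hm))

lemma deficit_peak (hq : 0 < q + 1) (hm : q < m) : deficit q m (peak q m) = 0 := by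
  rw [deficit, div_self (peak_pos hq hm).ne', Real.one_rpow, sub_self]

lemma hasDerivAt_deficit (hq : 0 < q + 1) (hm : q < m) (hs : 0 < s) :
    HasDerivAt (deficit q m) (-((m - q) * (1 - deficit q m s) / s)) s := by
  have hquot : s / peak q m ≠ 0 := (div_pos hs (peak_pos hq hm)).ne'
  refine ((((hasDerivAt_id s).div_const (peak q m)).rpow_const (p := m - q)
    (Or.inl hquot)).const_sub 1).congr_deriv ?_
  rw [one_sub_deficit, id_eq, Real.rpow_sub_one hquot]
  have := (peak_pos hq hm).ne'
  field_simp

lemma ofDeficit_deficit (hq : 0 < q + 1) (hm : q < m) (hs : 0 ≤ s) :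
    ofDeficit q m (deficit q m s) = s := by
  have hpk := peak_pos hq hm
  rw [ofDeficit, one_sub_deficit, ← Real.rpow_mul (div_nonneg hs hpk.le),
    mul_one_div_cancel (sub_pos.2 hm).ne', Real.rpow_one, mul_div_cancel₀ _ hpk.ne']

lemma deficit_ofDeficit (hq : 0 < q + 1) (hm : q < m) {x : ℝ} (hx : x ≤ 1) :
    deficit q m (ofDeficit q m x) = x := by
  rw [deficit, ofDeficit, mul_div_cancel_left₀ _ (peak_pos hq hm).ne',
    ← Real.rpow_mul (sub_nonneg.2 hx), one_div_mul_cancel (sub_pos.2 hm).ne', Real.rpow_one,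
    sub_sub_cancel]

lemma ofDeficit_zero : ofDeficit q m 0 = peak q m := by
  rw [ofDeficit, sub_zero, Real.one_rpow, mul_one]

lemma ofDeficit_pos (hq : 0 < q + 1) (hm : q < m) {x : ℝ} (hx : x < 1) : 0 < ofDeficit q m x :=
  mul_pos (peak_pos hq hm) (Real.rpow_pos_of_pos (sub_pos.2 hx) _)

lemma ofDeficit_lt_peak (hq : 0 < q + 1) (hm : q < m) {x : ℝ} (hx : x ∈ Ioc 0 1) :
    ofDeficit q m x < peak q m :=
  mul_lt_of_lt_one_right (peak_pos hq hm) (Real.rpow_lt_one (sub_nonneg.2 hx.2)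
    (sub_lt_self _ hx.1) (one_div_pos.2 (sub_pos.2 hm)))

lemma continuous_ofDeficit (hm : q < m) : Continuous (ofDeficit q m) :=
  ((continuous_const.sub continuous_id).rpow_const
    fun _ => Or.inr (one_div_pos.2 (sub_pos.2 hm)).le).const_mul _

lemma hasDerivAt_ofDeficit {x : ℝ} (hx : x < 1) :
    HasDerivAt (ofDeficit q m) (-(ofDeficit q m x / ((m - q) * (1 - x)))) x := by
  have hx1 : 1 - x ≠ 0 := (sub_pos.2 hx).ne'
  refine ((((hasDerivAt_id x).const_sub 1).rpow_const (p := 1 / (m - q))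
    (Or.inl hx1)).const_mul (peak q m)).congr_deriv ?_
  rw [id_eq, Real.rpow_sub_one hx1, ofDeficit]
  field_simp

lemma potential_eq_mul_deficit (hq : 0 < q + 1) (hm : q < m) (hs : 0 ≤ s) :
    potential q m s = s ^ (q + 1) / (q + 1) * deficit q m s := by
  have hm1 : m + 1 ≠ 0 := by linarith
  have hsplit : s ^ (m + 1) = s ^ (q + 1) * s ^ (m - q) := by
    rw [← Real.rpow_add_of_nonneg hs hq.le (sub_pos.2 hm).le]
    ring_nf
  rw [← sub_sub_cancel 1 (deficit q m s), one_sub_deficit_eq hq hm hs, potential, hsplit]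
  field_simp

lemma potential_pos (hq : 0 < q + 1) (hm : q < m) (hs : 0 < s) (hlt : s < peak q m) :
    0 < potential q m s := by
  rw [potential_eq_mul_deficit hq hm hs.le]
  have := deficit_pos hq hm hs.le hlt
  positivity

lemma potential_neg (hq : 0 < q + 1) (hm : q < m) (hs : peak q m < s) : potential q m s < 0 := by
  have hs0 : 0 < s := (peak_pos hq hm).trans hs
  rw [potential_eq_mul_deficit hq hm hs0.le]
  exact mul_neg_of_pos_of_neg (by positivity) (deficit_neg hq hm hs)

lemma potential_peak (hq : 0 < q + 1) (hm : q < m) : potential q m (peak q m) = 0 := by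
  rw [potential_eq_mul_deficit hq hm (peak_pos hq hm).le, deficit_peak hq hm, mul_zero]

lemma conjExponent_pos (hp : 1 < p) : 0 < p / (p - 1) :=
  div_pos (zero_lt_one.trans hp) (sub_pos.2 hp)

lemma kappa_pos (hp : 1 < p) (hq : 0 < q + 1) : 0 < kappa p q :=
  Real.rpow_pos_of_pos (div_pos (conjExponent_pos hp) hq) _

lemma speed_eq (hp : 1 < p) (hq : 0 < q + 1) (hm : q < m) (hs : 0 ≤ s) (hle : s ≤ peak q m) :
    speed p q m s = kappa p q * s ^ ((q + 1) / p) * deficit q m s ^ (1 / p) := by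
  have hX : 0 ≤ deficit q m s := by
    rcases hle.eq_or_lt with rfl | hlt
    · exact (deficit_peak hq hm).ge
    · exact (deficit_pos hq hm hs hlt).le
  have hc := div_pos (conjExponent_pos hp) hq
  have hsq : 0 ≤ s ^ (q + 1) := Real.rpow_nonneg hs _
  have hregroup : p / (p - 1) * (s ^ (q + 1) / (q + 1) * deficit q m s) =
      p / (p - 1) / (q + 1) * s ^ (q + 1) * deficit q m s := by ring
  rw [speed, potential_eq_mul_deficit hq hm hs, hregroup, Real.mul_rpow (by positivity) hX,
    Real.mul_rpow hc.le hsq, ← Real.rpow_mul hs, mul_one_div, kappa]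

lemma speed_pos (hp : 1 < p) (hq : 0 < q + 1) (hm : q < m) (hs : 0 < s) (hlt : s < peak q m) :
    0 < speed p q m s :=
  Real.rpow_pos_of_pos (mul_pos (conjExponent_pos hp) (potential_pos hq hm hs hlt)) _

lemma speed_peak (hp : 1 < p) (hq : 0 < q + 1) (hm : q < m) : speed p q m (peak q m) = 0 := by
  rw [speed, potential_peak hq hm, mul_zero, Real.zero_rpow (by positivity)]

lemma continuous_speed (hp : 0 ≤ p) (hq : 0 ≤ q + 1) (hm : 0 ≤ m + 1) :
    Continuous (speed p q m) :=
  ((continuous_potential hq hm).const_mul _).rpow_const fun _ => Or.inr (by positivity)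

lemma speed_rpow (hp : 1 < p) (hs : 0 ≤ potential q m s) (k : ℝ) :
    speed p q m s ^ k = (p / (p - 1) * potential q m s) ^ (k / p) := by
  rw [speed, ← Real.rpow_mul (mul_nonneg (conjExponent_pos hp).le hs), one_div_mul_eq_div]

lemma continuous_speed_rpow (hp : 1 < p) (hq : 0 < q + 1) (hm : q < m) :
    Continuous fun s => speed p q m s ^ (p - 1) :=
  (continuous_speed (by positivity) hq.le (by linarith)).rpow_const
    fun _ => Or.inr (sub_pos.2 hp).le

lemma speed_rpow_nonneg (hp : 1 < p) (hq : 0 < q + 1) (hm : q < m)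
    (hs : s ∈ Ioo 0 (peak q m)) : 0 ≤ speed p q m s ^ (p - 1) :=
  Real.rpow_nonneg (speed_pos hp hq hm hs.1 hs.2).le _

lemma hasDerivAt_speed_rpow (hp : 1 < p) (hq : 0 < q + 1) (hm : q < m) (hs : 0 < s)
    (hlt : s < peak q m) :
    HasDerivAt (fun t => speed p q m t ^ (p - 1)) ((s ^ q - s ^ m) / speed p q m s) s := by
  have hm1 : 0 < m + 1 := by linarith
  have hF := mul_pos (conjExponent_pos hp) (potential_pos hq hm hs hlt)
  have hd := ((hasDerivAt_potential hq.ne' hm1.ne' hs).const_mul (p / (p - 1))).rpow_const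
    (p := (p - 1) / p) (Or.inl hF.ne')
  refine (hd.congr_deriv ?_).congr_of_eventuallyEq ?_
  · have hS := (speed_pos hp hq hm hs hlt).ne'
    have hp1 : p - 1 ≠ 0 := (sub_pos.2 hp).ne'
    rw [show (p - 1) / p - 1 = -(1 / p) by field_simp; ring, Real.rpow_neg hF.le, ← speed]
    field_simp
  · filter_upwards [Ioo_mem_nhds hs hlt] with t ht
    exact speed_rpow hp (potential_pos hq hm ht.1 ht.2).le _

end Potential

/-- The first-order form of the ground state problem: `u' = -speed(u)` on `(0, ∞)`, with the
energy of the second-order equation equal to zero and `u` decreasing from `peak q m` to `0`. -/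
structure IsProfile (p q m : ℝ) (u : ℝ → ℝ) : Prop where
  apply_zero : u 0 = peak q m
  continuousWithinAt_zero : ContinuousWithinAt u (Ici 0) 0
  pos : ∀ r, 0 ≤ r → 0 < u r
  lt_peak : ∀ r, 0 < r → u r < peak q m
  hasDerivAt : ∀ r, 0 < r → HasDerivAt u (-speed p q m (u r)) r
  tendsto_zero : Tendsto u atTop (𝓝 0)

namespace IsPositiveSolution

variable {p q m : ℝ} {u : ℝ → ℝ}

lemma hasDerivAt_flux (h : IsPositiveSolution p q m u) {r : ℝ} (hr : 0 < r) :
    HasDerivAt (fun s => oddPow p (deriv u s)) (u r ^ q - u r ^ m) r := by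
  rw [← h.equation r hr, add_sub_cancel_right]
  exact (h.differentiableAt_flux r hr).hasDerivAt

lemma hasDerivAt_energy (h : IsPositiveSolution p q m u) (hp : 1 < p) (hq : q + 1 ≠ 0)
    (hm : m + 1 ≠ 0) {r : ℝ} (hr : 0 < r) :
    HasDerivAt (fun s => |deriv u s| ^ p - p / (p - 1) * potential q m (u s)) 0 r := by
  have hkinetic :=
    hasDerivAt_abs_oddPow_rpow (Real.HolderConjugate.conjExponent hp) (h.hasDerivAt_flux hr)
  have hpotential := ((hasDerivAt_potential hq hm (h.pos r hr.le)).comp r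
    (h.differentiableAt r hr).hasDerivAt).const_mul (p / (p - 1))
  refine (hkinetic.sub hpotential).congr_deriv ?_
  rw [Real.conjExponent]
  ring

lemma exists_energy_eq (h : IsPositiveSolution p q m u) (hp : 1 < p) (hq : q + 1 ≠ 0)
    (hm : m + 1 ≠ 0) :
    ∃ E : ℝ, ∀ r, 0 < r → |deriv u r| ^ p = p / (p - 1) * potential q m (u r) + E := by
  obtain ⟨E, hE⟩ := isOpen_Ioi.exists_is_const_of_deriv_eq_zero isPreconnected_Ioi
    (fun r hr => (h.hasDerivAt_energy hp hq hm hr).differentiableAt.differentiableWithinAt)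
    fun r hr => (h.hasDerivAt_energy hp hq hm hr).deriv
  exact ⟨E, fun r hr => by rw [← hE r hr, add_sub_cancel]⟩

lemma abs_deriv_rpow (h : IsPositiveSolution p q m u) (hp : 1 < p) (hq : 0 < q + 1)
    (hm : 0 < m + 1) {r : ℝ} (hr : 0 < r) :
    |deriv u r| ^ p = p / (p - 1) * potential q m (u r) := by
  have hp0 : 0 < p := zero_lt_one.trans hp
  obtain ⟨E, hE⟩ := h.exists_energy_eq hp hq.ne' hm.ne'
  have hpow : Tendsto (fun r => |deriv u r| ^ p) atTop (𝓝 E) := by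
    have hlim := ((((continuous_potential hq.le hm.le).tendsto 0).comp
      h.tendsto_zero).const_mul (p / (p - 1))).add_const E
    rw [potential_zero hq.ne' hm.ne', mul_zero, zero_add] at hlim
    exact hlim.congr' ((eventually_gt_atTop 0).mono fun r hr => (hE r hr).symm)
  have hE0 : 0 ≤ E := ge_of_tendsto' hpow fun r => by positivity
  have hroot : Tendsto (fun r => |deriv u r|) atTop (𝓝 (E ^ p⁻¹)) :=
    (hpow.rpow_const (p := p⁻¹) (Or.inr (inv_nonneg.2 hp0.le))).congr fun r =>
      Real.rpow_rpow_inv (abs_nonneg _) hp0.ne'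
  have hzero := eq_zero_of_tendsto_abs_deriv_atTop
    ((eventually_gt_atTop 0).mono h.differentiableAt) h.tendsto_zero hroot
  rw [hE r hr, (Real.rpow_eq_zero hE0 (inv_ne_zero hp0.ne')).1 hzero, add_zero]

lemma continuousOn (h : IsPositiveSolution p q m u) : ContinuousOn u (Ici 0) := by
  intro y hy
  rcases (mem_Ici.1 hy).eq_or_lt with rfl | hy
  · exact h.deriv_zero.continuousWithinAt
  · exact (h.differentiableAt y hy).continuousAt.continuousWithinAt

lemma potential_apply_zero (h : IsPositiveSolution p q m u) (hp : 1 < p) (hq : 0 < q + 1)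
    (hm : 0 < m + 1) : potential q m (u 0) = 0 := by
  have hp0 : 0 < p := zero_lt_one.trans hp
  have hc := conjExponent_pos hp
  have hpow : Tendsto (fun r => |deriv u r| ^ p) (𝓝[>] 0)
      (𝓝 (p / (p - 1) * potential q m (u 0))) :=
    ((((continuous_potential hq.le hm.le).tendsto _).comp
      (h.deriv_zero.continuousWithinAt.mono Ioi_subset_Ici_self)).const_mul _).congr'
      (eventually_mem_nhdsWithin.mono fun r hr => (h.abs_deriv_rpow hp hq hm hr).symm)
  have hnonneg : 0 ≤ p / (p - 1) * potential q m (u 0) :=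
    ge_of_tendsto' hpow fun r => by positivity
  have hroot := (hpow.rpow_const (p := p⁻¹) (Or.inr (inv_nonneg.2 hp0.le))).congr fun r =>
    Real.rpow_rpow_inv (abs_nonneg _) hp0.ne'
  have hzero := eq_abs_of_tendsto_abs_deriv_nhdsGT
    (eventually_mem_nhdsWithin.mono h.differentiableAt) h.deriv_zero hroot
  rw [abs_zero, Real.rpow_eq_zero hnonneg (inv_ne_zero hp0.ne')] at hzero
  exact (mul_eq_zero.1 hzero).resolve_left hc.ne'

lemma apply_zero (h : IsPositiveSolution p q m u) (hp : 1 < p) (hq : 0 < q + 1) (hm : q < m) :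
    u 0 = peak q m := by
  have hzero := h.potential_apply_zero hp hq (by linarith)
  rcases lt_trichotomy (u 0) (peak q m) with hlt | heq | hgt
  · exact absurd hzero (potential_pos hq hm (h.pos 0 le_rfl) hlt).ne'
  · exact heq
  · exact absurd hzero (potential_neg hq hm hgt).ne

lemma le_peak (h : IsPositiveSolution p q m u) (hp : 1 < p) (hq : 0 < q + 1) (hm : q < m)
    {r : ℝ} (hr : 0 < r) : u r ≤ peak q m := by
  by_contra! hlt
  have henergy := h.abs_deriv_rpow hp hq (by linarith) hr
  have hneg := mul_neg_of_pos_of_neg (conjExponent_pos hp) (potential_neg hq hm hlt)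
  exact hneg.not_ge (henergy ▸ Real.rpow_nonneg (abs_nonneg _) _)

lemma deriv_ne_zero_of_lt_peak (h : IsPositiveSolution p q m u) (hp : 1 < p) (hq : 0 < q + 1)
    (hm : q < m) {r : ℝ} (hr : 0 < r) (hlt : u r < peak q m) : deriv u r ≠ 0 := by
  intro hzero
  have henergy := h.abs_deriv_rpow hp hq (by linarith) hr
  rw [hzero, abs_zero, Real.zero_rpow (by positivity)] at henergy
  exact (mul_pos (conjExponent_pos hp)
    (potential_pos hq hm (h.pos r hr.le) hlt)).ne henergy

-- `peak q m` is a zero of the potential but not of its derivative, so it is not an equilibrium.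
lemma not_eventuallyEq_peak (h : IsPositiveSolution p q m u) (hq : 0 < q + 1) (hm : q < m)
    {r : ℝ} (hr : 0 < r) : ¬ u =ᶠ[𝓝 r] fun _ => peak q m := by
  intro heq
  have hflux : (fun s => oddPow p (deriv u s)) =ᶠ[𝓝 r] fun _ => 0 := by
    filter_upwards [heq.deriv] with s hs
    rw [hs, deriv_const, oddPow, mul_zero]
  have hbalance := (h.hasDerivAt_flux hr).unique
    ((hasDerivAt_const r (0 : ℝ)).congr_of_eventuallyEq hflux)
  rw [heq.self_of_nhds, sub_eq_zero] at hbalance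
  exact (Real.rpow_lt_rpow_of_exponent_lt (one_lt_peak hq hm) hm).ne hbalance

lemma lt_peak (h : IsPositiveSolution p q m u) (hp : 1 < p) (hq : 0 < q + 1) (hm : q < m)
    {r : ℝ} (hr : 0 < r) : u r < peak q m := by
  refine (h.le_peak hp hq hm hr).lt_of_ne fun heq => ?_
  obtain ⟨s, hs, hs_lt⟩ : ∃ s ∈ Ioo 0 r, u s < peak q m := by
    by_contra! hge
    refine h.not_eventuallyEq_peak hq hm (half_pos hr) ?_
    filter_upwards [Ioo_mem_nhds (half_pos hr) (half_lt_self hr)] with s hs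
    exact (h.le_peak hp hq hm hs.1).antisymm (hge s hs)
  obtain ⟨c, hc, hc_min⟩ := isCompact_Icc.exists_isMinOn (nonempty_Icc.2 hr.le)
    (h.continuousOn.mono Icc_subset_Ici_self)
  have hc_lt : u c < peak q m := (hc_min (Ioo_subset_Icc_self hs)).trans_lt hs_lt
  have hc0 : 0 < c := hc.1.lt_of_ne' fun h0 =>
    hc_lt.ne (by rw [h0, h.apply_zero hp hq hm])
  have hcr : c < r := hc.2.lt_of_ne fun h0 => hc_lt.ne (by rw [h0, heq])
  exact h.deriv_ne_zero_of_lt_peak hp hq hm hc0 hc_lt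
    (hc_min.isLocalMin (Icc_mem_nhds hc0 hcr)).deriv_eq_zero

lemma deriv_neg (h : IsPositiveSolution p q m u) (hp : 1 < p) (hq : 0 < q + 1) (hm : q < m)
    {r : ℝ} (hr : 0 < r) : deriv u r < 0 := by
  rcases hasDerivWithinAt_forall_lt_or_forall_gt_of_forall_ne (convex_Ioi 0)
    (fun x hx => (h.differentiableAt x hx).hasDerivAt.hasDerivWithinAt)
    (fun x hx => h.deriv_ne_zero_of_lt_peak hp hq hm hx (h.lt_peak hp hq hm hx))
    with hneg | hincreasing
  · exact hneg r hr
  · have hmono : StrictMonoOn u (Ici 0) := strictMonoOn_of_deriv_pos (convex_Ici 0) h.continuousOn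
      (by rwa [interior_Ici])
    have hlt := hmono self_mem_Ici (mem_Ici.2 zero_le_one) one_pos
    rw [h.apply_zero hp hq hm] at hlt
    exact absurd hlt (h.lt_peak hp hq hm one_pos).not_gt

lemma isProfile (h : IsPositiveSolution p q m u) (hp : 1 < p) (hq : 0 < q + 1) (hm : q < m) :
    IsProfile p q m u where
  apply_zero := h.apply_zero hp hq hm
  continuousWithinAt_zero := h.deriv_zero.continuousWithinAt
  pos := h.pos
  lt_peak _ hr := h.lt_peak hp hq hm hr
  hasDerivAt r hr := by
    refine (h.differentiableAt r hr).hasDerivAt.congr_deriv ?_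
    rw [speed, ← h.abs_deriv_rpow hp hq (by linarith) hr, one_div,
      Real.rpow_rpow_inv (abs_nonneg _) (by positivity), abs_of_neg (h.deriv_neg hp hq hm hr),
      neg_neg]
  tendsto_zero := h.tendsto_zero

end IsPositiveSolution

namespace IsProfile

variable {p q m : ℝ} {u : ℝ → ℝ}

lemma continuousOn (h : IsProfile p q m u) : ContinuousOn u (Ici 0) := by
  intro y hy
  rcases (mem_Ici.1 hy).eq_or_lt with rfl | hy
  · exact h.continuousWithinAt_zero
  · exact (h.hasDerivAt y hy).continuousAt.continuousWithinAt

lemma deriv_eq (h : IsProfile p q m u) {r : ℝ} (hr : 0 < r) : deriv u r = -speed p q m (u r) :=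
  (h.hasDerivAt r hr).deriv

lemma speed_pos (h : IsProfile p q m u) (hp : 1 < p) (hq : 0 < q + 1) (hm : q < m) {r : ℝ}
    (hr : 0 < r) : 0 < speed p q m (u r) :=
  GNOneDim.speed_pos hp hq hm (h.pos r hr.le) (h.lt_peak r hr)

lemma abs_deriv (h : IsProfile p q m u) (hp : 1 < p) (hq : 0 < q + 1) (hm : q < m) {r : ℝ}
    (hr : 0 < r) : |deriv u r| = speed p q m (u r) := by
  rw [h.deriv_eq hr, abs_neg, abs_of_pos (h.speed_pos hp hq hm hr)]

lemma strictAntiOn (h : IsProfile p q m u) (hp : 1 < p) (hq : 0 < q + 1) (hm : q < m) :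
    StrictAntiOn u (Ici 0) := by
  refine strictAntiOn_of_deriv_neg (convex_Ici 0) h.continuousOn fun r hr => ?_
  rw [interior_Ici] at hr
  rw [h.deriv_eq hr, Left.neg_neg_iff]
  exact h.speed_pos hp hq hm hr

lemma tendsto_speed (h : IsProfile p q m u) (hp : 1 < p) (hq : 0 < q + 1) (hm : q < m) :
    Tendsto (fun r => speed p q m (u r)) (𝓝[>] 0) (𝓝 0) := by
  have hlim := ((continuous_speed (p := p) (by linarith) hq.le
    (show 0 ≤ m + 1 by linarith)).tendsto (u 0)).comp
    (h.continuousWithinAt_zero.mono Ioi_subset_Ici_self)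
  rwa [h.apply_zero, speed_peak hp hq hm] at hlim

lemma hasDerivWithinAt_zero (h : IsProfile p q m u) (hp : 1 < p) (hq : 0 < q + 1) (hm : q < m) :
    HasDerivWithinAt u 0 (Ici 0) 0 := by
  have hderiv : Tendsto (deriv u) (𝓝[>] 0) (𝓝 0) :=
    (neg_zero (G := ℝ) ▸ (h.tendsto_speed hp hq hm).neg).congr'
      (eventually_mem_nhdsWithin.mono fun r hr => (h.deriv_eq hr).symm)
  exact hasDerivWithinAt_Ici_of_tendsto_deriv (s := Ioi 0)
    (fun r hr => (h.hasDerivAt r hr).differentiableAt.differentiableWithinAt)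
    (h.continuousWithinAt_zero.mono Ioi_subset_Ici_self) self_mem_nhdsWithin hderiv

lemma hasDerivAt_speed_rpow (h : IsProfile p q m u) (hp : 1 < p) (hq : 0 < q + 1) (hm : q < m)
    {r : ℝ} (hr : 0 < r) :
    HasDerivAt (fun s => speed p q m (u s) ^ (p - 1)) (u r ^ m - u r ^ q) r := by
  refine ((GNOneDim.hasDerivAt_speed_rpow hp hq hm (h.pos r hr.le)
    (h.lt_peak r hr)).comp r (h.hasDerivAt r hr)).congr_deriv ?_
  have := (h.speed_pos hp hq hm hr).ne'
  field_simp
  ring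

lemma isPositiveSolution (h : IsProfile p q m u) (hp : 1 < p) (hq : 0 < q + 1) (hm : q < m) :
    IsPositiveSolution p q m u := by
  have hflux : ∀ r, 0 < r →
      HasDerivAt (fun s => |deriv u s| ^ (p - 2) * deriv u s) (u r ^ q - u r ^ m) r := by
    intro r hr
    refine ((h.hasDerivAt_speed_rpow hp hq hm hr).neg.congr_deriv
      (neg_sub _ _)).congr_of_eventuallyEq ?_
    filter_upwards [Ioi_mem_nhds hr] with s hs
    rw [h.deriv_eq hs]
    exact oddPow_neg_of_pos (h.speed_pos hp hq hm hs)
  exact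
    { pos := h.pos
      differentiableAt := fun r hr => (h.hasDerivAt r hr).differentiableAt
      differentiableAt_flux := fun r hr => (hflux r hr).differentiableAt
      equation := fun r hr => by rw [(hflux r hr).deriv, sub_add_cancel]
      deriv_zero := h.hasDerivWithinAt_zero hp hq hm
      tendsto_zero := h.tendsto_zero }

lemma congr {w : ℝ → ℝ} (h : IsProfile p q m u) (heq : ∀ r, 0 ≤ r → w r = u r) :
    IsProfile p q m w where
  apply_zero := by rw [heq 0 le_rfl, h.apply_zero]
  continuousWithinAt_zero := h.continuousWithinAt_zero.congr heq (heq 0 le_rfl)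
  pos r hr := heq r hr ▸ h.pos r hr
  lt_peak r hr := heq r hr.le ▸ h.lt_peak r hr
  hasDerivAt r hr := by
    rw [heq r hr.le]
    refine (h.hasDerivAt r hr).congr_of_eventuallyEq ?_
    filter_upwards [Ioi_mem_nhds hr] with s hs using heq s (le_of_lt hs)
  tendsto_zero := h.tendsto_zero.congr'
    ((eventually_ge_atTop 0).mono fun r hr => (heq r hr).symm)

end IsProfile

section IncompleteBeta

variable {a b : ℝ}

lemma intervalIntegrable_incBeta (ha : 0 < a) {x y : ℝ} (hx : x ∈ Ico (0 : ℝ) 1)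
    (hy : y ∈ Ico (0 : ℝ) 1) :
    IntervalIntegrable (fun t : ℝ => t ^ (a - 1) * (1 - t) ^ (b - 1)) volume x y := by
  refine (intervalIntegral.intervalIntegrable_rpow' (by linarith)).mul_continuousOn ?_
  intro t ht
  have ht1 : t < 1 := lt_of_le_of_lt ht.2 (max_lt hx.2 hy.2)
  exact ((continuousAt_const.sub continuousAt_id).rpow_const
    (Or.inl (sub_pos.2 ht1).ne')).continuousWithinAt

lemma incBeta_zero : incBeta 0 a b = 0 := by simp [incBeta]

lemma hasDerivAt_incBeta (ha : 0 < a) {x : ℝ} (hx : x ∈ Ioo (0 : ℝ) 1) :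
    HasDerivAt (fun x => incBeta x a b) (x ^ (a - 1) * (1 - x) ^ (b - 1)) x := by
  refine intervalIntegral.integral_hasDerivAt_right (intervalIntegrable_incBeta ha (by simp)
    ⟨hx.1.le, hx.2⟩) ?_ ?_
  · refine ContinuousOn.stronglyMeasurableAtFilter isOpen_Ioo ?_ x hx
    intro t ht
    exact ((continuousAt_id.rpow_const (Or.inl ht.1.ne')).mul
      ((continuousAt_const.sub continuousAt_id).rpow_const
      (Or.inl (sub_pos.2 ht.2).ne'))).continuousWithinAt
  · exact (continuousAt_id.rpow_const (Or.inl hx.1.ne')).mul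
      ((continuousAt_const.sub continuousAt_id).rpow_const
      (Or.inl (sub_pos.2 hx.2).ne'))

lemma continuousOn_incBeta (ha : 0 < a) : ContinuousOn (fun x => incBeta x a b) (Ico 0 1) := by
  intro x hx
  obtain ⟨y, hxy, hy1⟩ := exists_between hx.2
  have hy0 : 0 < y := lt_of_le_of_lt hx.1 hxy
  have h := intervalIntegral.continuousOn_primitive_interval
    ((intervalIntegrable_iff_integrableOn_Icc_of_le hy0.le).1
      (intervalIntegrable_incBeta (b := b) ha (x := 0) (y := y) (by simp) ⟨hy0.le, hy1⟩) |>.mono_set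
        (by rw [uIcc_of_le hy0.le]))
  rw [uIcc_of_le hy0.le] at h
  refine (h x ⟨hx.1, hxy.le⟩).mono_of_mem_nhdsWithin ?_
  rw [mem_nhdsWithin]
  exact ⟨Iio y, isOpen_Iio, hxy, fun z hz => ⟨hz.2.1, hz.1.le⟩⟩

lemma strictMonoOn_incBeta (ha : 0 < a) : StrictMonoOn (fun x => incBeta x a b) (Ico 0 1) := by
  refine strictMonoOn_of_deriv_pos (convex_Ico 0 1) (continuousOn_incBeta ha) fun x hx => ?_
  rw [interior_Ico] at hx
  rw [(hasDerivAt_incBeta ha hx).deriv]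
  exact mul_pos (Real.rpow_pos_of_pos hx.1 _) (Real.rpow_pos_of_pos (by linarith [hx.2]) _)

lemma inv_one_sub_le_incBeta_integrand (ha : a ≤ 1) (hb : b ≤ 0) {x : ℝ}
    (hx : x ∈ Ioo (0 : ℝ) 1) : (1 - x)⁻¹ ≤ x ^ (a - 1) * (1 - x) ^ (b - 1) := by
  have hx1 : 0 < 1 - x := sub_pos.2 hx.2
  have hleft : 1 ≤ x ^ (a - 1) :=
    Real.one_le_rpow_of_pos_of_le_one_of_nonpos hx.1 hx.2.le (by linarith)
  have hright : (1 - x)⁻¹ ≤ (1 - x) ^ (b - 1) := by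
    rw [← Real.rpow_neg_one]
    exact Real.rpow_le_rpow_of_exponent_ge hx1 (by linarith [hx.1]) (by linarith)
  exact hright.trans (le_mul_of_one_le_left (Real.rpow_nonneg hx1.le _) hleft)

lemma neg_log_le_incBeta (ha : 0 < a) (ha1 : a ≤ 1) (hb : b ≤ 0) {x : ℝ}
    (hx : x ∈ Ico (0 : ℝ) 1) : -Real.log (1 - x) ≤ incBeta x a b := by
  have hd : ∀ y ∈ Ioo (0 : ℝ) 1, HasDerivAt (fun x => incBeta x a b + Real.log (1 - x))
      (y ^ (a - 1) * (1 - y) ^ (b - 1) + -1 / (1 - y)) y := fun y hy =>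
    (hasDerivAt_incBeta ha hy).add (((hasDerivAt_id y).const_sub 1).log (sub_pos.2 hy.2).ne')
  have hmono : MonotoneOn (fun x => incBeta x a b + Real.log (1 - x)) (Ico 0 1) := by
    refine monotoneOn_of_deriv_nonneg (convex_Ico 0 1) ((continuousOn_incBeta ha).add fun y hy =>
      ((continuousAt_const.sub continuousAt_id).log (sub_pos.2 hy.2).ne').continuousWithinAt) ?_ ?_
    · rw [interior_Ico]
      exact fun y hy => (hd y hy).differentiableAt.differentiableWithinAt
    · rw [interior_Ico]
      intro y hy
      rw [(hd y hy).deriv, neg_div, one_div, ← sub_eq_add_neg, sub_nonneg]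
      exact inv_one_sub_le_incBeta_integrand ha1 hb hy
  have hle := hmono (left_mem_Ico.2 one_pos) hx hx.1
  simp only [incBeta_zero, sub_zero, Real.log_one, add_zero] at hle
  linarith

lemma bijOn_incBeta (ha : 0 < a) (ha1 : a ≤ 1) (hb : b ≤ 0) :
    BijOn (fun x => incBeta x a b) (Ico 0 1) (Ici 0) := by
  refine ⟨fun x hx => ?_, (strictMonoOn_incBeta ha).injOn, fun y hy => ?_⟩
  · have hle := (strictMonoOn_incBeta (b := b) ha).monotoneOn (left_mem_Ico.2 one_pos) hx hx.1
    exact incBeta_zero.symm.trans_le hle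
  · have hz0 : 0 ≤ 1 - Real.exp (-y) :=
      sub_nonneg.2 (Real.exp_le_one_iff.2 (neg_nonpos.2 hy))
    have hz1 : 1 - Real.exp (-y) < 1 := sub_lt_self _ (Real.exp_pos _)
    have hy_le : y ≤ incBeta (1 - Real.exp (-y)) a b := by
      simpa only [sub_sub_cancel, Real.log_exp, neg_neg] using
        neg_log_le_incBeta ha ha1 hb ⟨hz0, hz1⟩
    obtain ⟨x, hx, hxy⟩ := intermediate_value_Icc hz0
      ((continuousOn_incBeta (b := b) ha).mono fun t ht => ⟨ht.1, ht.2.trans_lt hz1⟩)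
      ⟨incBeta_zero.trans_le hy, hy_le⟩
    exact ⟨x, ⟨hx.1, hx.2.trans_lt hz1⟩, hxy⟩

lemma invOn_incBetaInv (ha : 0 < a) (ha1 : a ≤ 1) (hb : b ≤ 0) :
    InvOn (fun y => incBetaInv y a b) (fun x => incBeta x a b) (Ico 0 1) (Ici 0) :=
  (bijOn_incBeta ha ha1 hb).invOn_invFunOn

lemma incBetaInv_mem (ha : 0 < a) (ha1 : a ≤ 1) (hb : b ≤ 0) {y : ℝ} (hy : 0 ≤ y) :
    incBetaInv y a b ∈ Ico (0 : ℝ) 1 :=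
  (bijOn_incBeta ha ha1 hb).surjOn.mapsTo_invFunOn hy

lemma incBeta_incBetaInv (ha : 0 < a) (ha1 : a ≤ 1) (hb : b ≤ 0) {y : ℝ} (hy : 0 ≤ y) :
    incBeta (incBetaInv y a b) a b = y :=
  (invOn_incBetaInv ha ha1 hb).2 hy

lemma incBetaInv_incBeta (ha : 0 < a) (ha1 : a ≤ 1) (hb : b ≤ 0) {x : ℝ}
    (hx : x ∈ Ico (0 : ℝ) 1) : incBetaInv (incBeta x a b) a b = x :=
  (invOn_incBetaInv ha ha1 hb).1 hx

lemma incBetaInv_zero (ha : 0 < a) (ha1 : a ≤ 1) (hb : b ≤ 0) : incBetaInv 0 a b = 0 := by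
  have := incBetaInv_incBeta (b := b) ha ha1 hb (left_mem_Ico.2 one_pos)
  rwa [incBeta_zero] at this

lemma strictMonoOn_incBetaInv (ha : 0 < a) (ha1 : a ≤ 1) (hb : b ≤ 0) :
    StrictMonoOn (fun y => incBetaInv y a b) (Ici 0) := by
  intro x hx y hy hxy
  refine ((strictMonoOn_incBeta (b := b) ha).lt_iff_lt (incBetaInv_mem ha ha1 hb hx)
    (incBetaInv_mem ha ha1 hb hy)).1 ?_
  simpa only [incBeta_incBetaInv ha ha1 hb hx, incBeta_incBetaInv ha ha1 hb hy] using hxy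

lemma image_incBetaInv (ha : 0 < a) (ha1 : a ≤ 1) (hb : b ≤ 0) :
    (fun y => incBetaInv y a b) '' Ici 0 = Ico 0 1 := by
  ext x
  constructor
  · rintro ⟨y, hy, rfl⟩
    exact incBetaInv_mem ha ha1 hb hy
  · intro hx
    exact ⟨incBeta x a b, (bijOn_incBeta ha ha1 hb).mapsTo hx, incBetaInv_incBeta ha ha1 hb hx⟩

lemma incBetaInv_pos (ha : 0 < a) (ha1 : a ≤ 1) (hb : b ≤ 0) {y : ℝ} (hy : 0 < y) :
    0 < incBetaInv y a b := by
  have := strictMonoOn_incBetaInv (b := b) ha ha1 hb self_mem_Ici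
    (mem_Ici.2 hy.le) hy
  simpa only [incBetaInv_zero ha ha1 hb] using this

lemma continuousAt_incBetaInv (ha : 0 < a) (ha1 : a ≤ 1) (hb : b ≤ 0) {y : ℝ} (hy : 0 < y) :
    ContinuousAt (fun y => incBetaInv y a b) y := by
  refine (strictMonoOn_incBetaInv ha ha1 hb).continuousAt_of_image_mem_nhds (Ici_mem_nhds hy) ?_
  rw [image_incBetaInv ha ha1 hb]
  exact Ico_mem_nhds (incBetaInv_pos ha ha1 hb hy) (incBetaInv_mem ha ha1 hb hy.le).2

lemma continuousWithinAt_incBetaInv_zero (ha : 0 < a) (ha1 : a ≤ 1) (hb : b ≤ 0) :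
    ContinuousWithinAt (fun y => incBetaInv y a b) (Ici 0) 0 := by
  refine (strictMonoOn_incBetaInv ha ha1 hb).continuousWithinAt_right_of_image_mem_nhdsWithin
    self_mem_nhdsWithin ?_
  rw [image_incBetaInv ha ha1 hb, incBetaInv_zero ha ha1 hb]
  exact Ico_mem_nhdsGE one_pos

lemma hasDerivAt_incBetaInv (ha : 0 < a) (ha1 : a ≤ 1) (hb : b ≤ 0) {y : ℝ} (hy : 0 < y) :
    HasDerivAt (fun y => incBetaInv y a b)
      (incBetaInv y a b ^ (a - 1) * (1 - incBetaInv y a b) ^ (b - 1))⁻¹ y := by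
  have h0 := incBetaInv_pos (b := b) ha ha1 hb hy
  have h1 := (incBetaInv_mem (b := b) ha ha1 hb hy.le).2
  refine HasDerivAt.of_local_left_inverse (continuousAt_incBetaInv ha ha1 hb hy)
    (hasDerivAt_incBeta ha ⟨h0, h1⟩) ?_ ?_
  · exact (mul_pos (Real.rpow_pos_of_pos h0 _) (Real.rpow_pos_of_pos (by linarith) _)).ne'
  · filter_upwards [Ioi_mem_nhds hy] with z hz using incBeta_incBetaInv ha ha1 hb (le_of_lt hz)

lemma tendsto_incBetaInv (ha : 0 < a) (ha1 : a ≤ 1) (hb : b ≤ 0) :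
    Tendsto (fun y => incBetaInv y a b) atTop (𝓝 1) := by
  rw [tendsto_order]
  refine ⟨fun c hc => ?_, fun c hc => ?_⟩
  · have hmem : max c 0 ∈ Ico (0 : ℝ) 1 := ⟨le_max_right _ _, max_lt hc one_pos⟩
    filter_upwards [eventually_gt_atTop (incBeta (max c 0) a b), eventually_ge_atTop 0]
      with y hy hy0
    have := strictMonoOn_incBetaInv (b := b) ha ha1 hb
      ((bijOn_incBeta ha ha1 hb).mapsTo hmem) (mem_Ici.2 hy0) hy
    simp only [incBetaInv_incBeta ha ha1 hb hmem] at this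
    exact (le_max_left _ _).trans_lt this
  · filter_upwards [eventually_ge_atTop 0] with y hy
    exact (incBetaInv_mem ha ha1 hb hy).2.trans hc

end IncompleteBeta

section ClosedForm

variable {p q m : ℝ}

lemma Cbar_eq (hp : 1 < p) (hq : 0 < q + 1) (hm : q < m) :
    Cbar p q m = (m - q) * kappa p q * peak q m ^ ((q + 1) / p - 1) := by
  have hm1 : 0 < m + 1 := by linarith
  have hmq : m - q ≠ 0 := (sub_pos.2 hm).ne'
  have hp0 : p ≠ 0 := by positivity
  have hexp_m : (1 + q - p) / (p * (m - q)) = 1 / (m - q) * ((q + 1) / p - 1) := by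
    field_simp
    ring
  have hexp_q : (p - m - 1) / (p * (m - q)) = -(1 / p) - 1 / (m - q) * ((q + 1) / p - 1) := by
    field_simp
    ring
  rw [Cbar, kappa, peak, ← Real.rpow_mul (by positivity),
    Real.div_rpow (conjExponent_pos hp).le hq.le, Real.div_rpow hm1.le hq.le, hexp_m, hexp_q,
    Real.rpow_sub hq, Real.rpow_neg hq.le]
  ring

lemma Cbar_pos (hp : 1 < p) (hq : 0 < q + 1) (hm : q < m) : 0 < Cbar p q m := by
  rw [Cbar_eq hp hq hm]
  exact mul_pos (mul_pos (sub_pos.2 hm) (kappa_pos hp hq)) (Real.rpow_pos_of_pos (peak_pos hq hm) _)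

-- The second factor is the rate `X'` along a profile, so the product is `B(X)'`.
lemma incBeta_integrand_mul_rate (hp : 1 < p) (hq : 0 < q + 1) (hm : q < m) {s : ℝ} (hs : 0 < s)
    (hlt : s < peak q m) :
    deficit q m s ^ (1 - 1 / p - 1) *
        (1 - deficit q m s) ^ ((p - 1 - q) / (p * (m - q)) - 1) *
      ((m - q) * (1 - deficit q m s) / s * speed p q m s) = Cbar p q m := by
  have hX := deficit_pos hq hm hs.le hlt
  have hY := one_sub_deficit_pos hq hm hs
  have hpk := peak_pos hq hm
  have hmq : m - q ≠ 0 := (sub_pos.2 hm).ne'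
  have hp0 : p ≠ 0 := by positivity
  have hexp : (m - q) * ((p - 1 - q) / (p * (m - q))) = -((q + 1) / p - 1) := by
    field_simp
    ring
  have hpow : (1 - deficit q m s) ^ ((p - 1 - q) / (p * (m - q))) =
      peak q m ^ ((q + 1) / p - 1) * (s / s ^ ((q + 1) / p)) := by
    have hsp := div_pos hs hpk
    rw [one_sub_deficit, ← Real.rpow_mul hsp.le, hexp, Real.rpow_neg hsp.le,
      Real.div_rpow hs.le hpk.le, Real.rpow_sub_one hs.ne']
    field_simp
  rw [speed_eq hp hq hm hs.le hlt.le, Cbar_eq hp hq hm, Real.rpow_sub_one hY.ne', hpow,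
    show 1 - 1 / p - 1 = -(1 / p) by ring, Real.rpow_neg hX.le]
  have := (Real.rpow_pos_of_pos hX (1 / p)).ne'
  have := (Real.rpow_pos_of_pos hs ((q + 1) / p)).ne'
  field_simp

lemma one_sub_one_div_mem (hp : 1 < p) : 1 - 1 / p ∈ Ioo 0 1 :=
  ⟨sub_pos.2 ((div_lt_one (by positivity)).2 hp), sub_lt_self _ (by positivity)⟩

lemma closedForm_exponent_nonpos (hp : 0 ≤ p) (hqp : p - 1 ≤ q) (hm : q ≤ m) :
    (p - 1 - q) / (p * (m - q)) ≤ 0 :=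
  div_nonpos_of_nonpos_of_nonneg (sub_nonpos.2 hqp) (mul_nonneg hp (sub_nonneg.2 hm))

namespace IsProfile

variable {u : ℝ → ℝ}

lemma deficit_mem (h : IsProfile p q m u) (hq : 0 < q + 1) (hm : q < m) {r : ℝ} (hr : 0 < r) :
    deficit q m (u r) ∈ Ioo 0 1 :=
  ⟨deficit_pos hq hm (h.pos r hr.le).le (h.lt_peak r hr), deficit_lt_one hq hm (h.pos r hr.le)⟩

lemma deficit_apply_zero (h : IsProfile p q m u) (hq : 0 < q + 1) (hm : q < m) :
    deficit q m (u 0) = 0 := by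
  rw [h.apply_zero, deficit_peak hq hm]

lemma deficit_mem_Ico (h : IsProfile p q m u) (hq : 0 < q + 1) (hm : q < m) {r : ℝ}
    (hr : 0 ≤ r) : deficit q m (u r) ∈ Ico 0 1 := by
  rcases hr.eq_or_lt with rfl | hr
  · rw [h.deficit_apply_zero hq hm]
    exact left_mem_Ico.2 one_pos
  · exact Ioo_subset_Ico_self (h.deficit_mem hq hm hr)

lemma continuousOn_deficit (h : IsProfile p q m u) (hq : 0 < q + 1) (hm : q < m) :
    ContinuousOn (fun r => deficit q m (u r)) (Ici 0) := fun r hr =>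
  (hasDerivAt_deficit hq hm (h.pos r hr)).continuousAt.comp_continuousWithinAt (h.continuousOn r hr)

lemma hasDerivAt_deficit (h : IsProfile p q m u) (hq : 0 < q + 1) (hm : q < m) {r : ℝ}
    (hr : 0 < r) :
    HasDerivAt (fun r => deficit q m (u r))
      ((m - q) * (1 - deficit q m (u r)) / u r * speed p q m (u r)) r :=
  ((GNOneDim.hasDerivAt_deficit hq hm (h.pos r hr.le)).comp r (h.hasDerivAt r hr)).congr_deriv
    (neg_mul_neg _ _)

lemma incBeta_deficit (h : IsProfile p q m u) (hp : 1 < p) (hq : 0 < q + 1) (hm : q < m) {r : ℝ}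
    (hr : 0 ≤ r) :
    incBeta (deficit q m (u r)) (1 - 1 / p) ((p - 1 - q) / (p * (m - q))) = Cbar p q m * r := by
  have ha := (one_sub_one_div_mem hp).1
  have hzero : incBeta (deficit q m (u 0)) (1 - 1 / p) ((p - 1 - q) / (p * (m - q))) = 0 := by
    rw [h.deficit_apply_zero hq hm, incBeta_zero]
  rcases hr.eq_or_lt with rfl | hr
  · rw [hzero, mul_zero]
  obtain ⟨c, -, hslope⟩ := exists_hasDerivAt_eq_slope
    (fun s => incBeta (deficit q m (u s)) (1 - 1 / p) ((p - 1 - q) / (p * (m - q))))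
    (fun _ => Cbar p q m) hr
    (((continuousOn_incBeta ha).comp (h.continuousOn_deficit hq hm)
      fun s hs => h.deficit_mem_Ico hq hm hs).mono Icc_subset_Ici_self)
    fun s hs => by
      refine ((hasDerivAt_incBeta ha (h.deficit_mem hq hm hs.1)).comp s
        (h.hasDerivAt_deficit hq hm hs.1)).congr_deriv ?_
      exact incBeta_integrand_mul_rate hp hq hm (h.pos s hs.1.le) (h.lt_peak s hs.1)
  rw [hslope, hzero, sub_zero, sub_zero, div_mul_cancel₀ _ hr.ne']

lemma eq_closedForm (h : IsProfile p q m u) (hp : 1 < p) (hqp : p - 1 ≤ q) (hm : q < m) {r : ℝ}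
    (hr : 0 ≤ r) : u r = closedForm p q m r := by
  have hq : 0 < q + 1 := by linarith
  obtain ⟨ha, ha1⟩ := one_sub_one_div_mem hp
  change u r = ofDeficit q m (incBetaInv (Cbar p q m * r) _ _)
  rw [← h.incBeta_deficit hp hq hm hr, incBetaInv_incBeta ha ha1.le
    (closedForm_exponent_nonpos (by linarith) hqp hm.le) (h.deficit_mem_Ico hq hm hr),
    ofDeficit_deficit hq hm (h.pos r hr).le]

end IsProfile

lemma hasDerivAt_closedForm (hp : 1 < p) (hqp : p - 1 ≤ q) (hm : q < m) {r : ℝ} (hr : 0 < r) :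
    HasDerivAt (closedForm p q m) (-speed p q m (closedForm p q m r)) r := by
  have hq : 0 < q + 1 := by linarith
  have hb := closedForm_exponent_nonpos (by linarith) hqp hm.le
  obtain ⟨ha, ha1⟩ := one_sub_one_div_mem hp
  have hCr : 0 < Cbar p q m * r := mul_pos (Cbar_pos hp hq hm) hr
  have hX0 := incBetaInv_pos ha ha1.le hb hCr
  have hX1 := (incBetaInv_mem ha ha1.le hb hCr.le).2
  have hu := ofDeficit_pos hq hm hX1
  have hX := (hasDerivAt_incBetaInv ha ha1.le hb hCr).comp r
    ((hasDerivAt_id r).const_mul (Cbar p q m))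
  refine ((hasDerivAt_ofDeficit hX1).comp r hX).congr_deriv ?_
  have hrate := incBeta_integrand_mul_rate hp hq hm hu (ofDeficit_lt_peak hq hm ⟨hX0, hX1.le⟩)
  rw [deficit_ofDeficit hq hm hX1.le] at hrate
  change _ = -speed p q m (ofDeficit q m (incBetaInv (Cbar p q m * r) _ _))
  generalize incBetaInv (Cbar p q m * r) _ _ = x at hX0 hX1 hu hrate ⊢
  rw [← hrate]
  have := (Real.rpow_pos_of_pos hX0 (1 - 1 / p - 1)).ne'
  have := (Real.rpow_pos_of_pos (sub_pos.2 hX1) ((p - 1 - q) / (p * (m - q)) - 1)).ne'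
  have := (sub_pos.2 hX1).ne'
  have := (sub_pos.2 hm).ne'
  have := hu.ne'
  field_simp

lemma isProfile_closedForm (hp : 1 < p) (hqp : p - 1 ≤ q) (hm : q < m) :
    IsProfile p q m (closedForm p q m) := by
  have hq : 0 < q + 1 := by linarith
  have hC := Cbar_pos hp hq hm
  have hb := closedForm_exponent_nonpos (by linarith) hqp hm.le
  obtain ⟨ha, ha1⟩ := one_sub_one_div_mem hp
  have hform : closedForm p q m = fun r => ofDeficit q m
    (incBetaInv (Cbar p q m * r) (1 - 1 / p) ((p - 1 - q) / (p * (m - q)))) := rfl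
  have hcont := continuous_ofDeficit hm
  refine ⟨?_, ?_, fun r hr => ?_, fun r hr => ?_,
    fun r hr => hasDerivAt_closedForm hp hqp hm hr, ?_⟩
  · rw [hform]
    simp only [mul_zero, incBetaInv_zero ha ha1.le hb, ofDeficit_zero]
  · refine hcont.continuousAt.comp_continuousWithinAt (ContinuousWithinAt.comp (t := Ici 0)
      (g := fun y => incBetaInv y (1 - 1 / p) ((p - 1 - q) / (p * (m - q)))) ?_
      (continuous_const_mul _).continuousWithinAt fun r hr => mul_nonneg hC.le hr)
    simpa only [mul_zero] using continuousWithinAt_incBetaInv_zero ha ha1.le hb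
  · exact ofDeficit_pos hq hm (incBetaInv_mem ha ha1.le hb (mul_nonneg hC.le hr)).2
  · exact ofDeficit_lt_peak hq hm ⟨incBetaInv_pos ha ha1.le hb (mul_pos hC hr),
      (incBetaInv_mem ha ha1.le hb (mul_pos hC hr).le).2.le⟩
  · have hzero : ofDeficit q m 1 = 0 := by
      rw [ofDeficit, sub_self, Real.zero_rpow (one_div_pos.2 (sub_pos.2 hm)).ne', mul_zero]
    exact hzero ▸ (hcont.tendsto 1).comp
      ((tendsto_incBetaInv ha ha1.le hb).comp (tendsto_id.const_mul_atTop hC))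

lemma isPositiveSolution_iff (hp : 1 < p) (hqp : p - 1 ≤ q) (hm : q < m) (u : ℝ → ℝ) :
    IsPositiveSolution p q m u ↔ ∀ r : ℝ, 0 ≤ r → u r = closedForm p q m r := by
  have hq : 0 < q + 1 := by linarith
  exact ⟨fun h r hr => (h.isProfile hp hq hm).eq_closedForm hp hqp hm hr,
    fun h => ((isProfile_closedForm hp hqp hm).congr h).isPositiveSolution hp hq hm⟩

end ClosedForm

section Comparison

variable {f : ℝ → ℝ} {c R r : ℝ}

lemma le_mul_exp_of_deriv_le (hf : ∀ s, R ≤ s → DifferentiableAt ℝ f s)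
    (hpos : ∀ s, R ≤ s → 0 < f s) (hd : ∀ s, R ≤ s → deriv f s ≤ -c * f s) (hr : R ≤ r) :
    f r ≤ f R * Real.exp (-c * (r - R)) := by
  have hlog : ∀ s, R ≤ s → HasDerivAt (fun s => Real.log (f s)) (deriv f s / f s) s :=
    fun s hs => (hf s hs).hasDerivAt.log (hpos s hs).ne'
  have hmv := (convex_Ici R).image_sub_le_mul_sub_of_deriv_le
    (fun s hs => (hlog s hs).continuousAt.continuousWithinAt)
    (fun s hs => (hlog s (interior_subset hs)).differentiableAt.differentiableWithinAt)
    (fun s hs => by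
      have hs := interior_subset hs
      rw [(hlog s hs).deriv, div_le_iff₀ (hpos s hs)]
      exact hd s hs) R self_mem_Ici r hr hr
  rw [← Real.log_le_log_iff (hpos r hr) (mul_pos (hpos R le_rfl) (Real.exp_pos _)),
    Real.log_mul (hpos R le_rfl).ne' (Real.exp_pos _).ne', Real.log_exp]
  linarith

lemma mul_sub_le_rpow_neg_of_deriv_le {δ : ℝ} (hδ : 0 ≤ δ)
    (hf : ∀ s, R ≤ s → DifferentiableAt ℝ f s) (hpos : ∀ s, R ≤ s → 0 < f s)
    (hd : ∀ s, R ≤ s → deriv f s ≤ -c * f s ^ (δ + 1)) (hr : R ≤ r) :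
    δ * c * (r - R) ≤ f r ^ (-δ) := by
  have hpow : ∀ s, R ≤ s →
      HasDerivAt (fun s => f s ^ (-δ)) (deriv f s * (-δ) * f s ^ (-δ - 1)) s :=
    fun s hs => (hf s hs).hasDerivAt.rpow_const (Or.inl (hpos s hs).ne')
  have hmv := (convex_Ici R).mul_sub_le_image_sub_of_le_deriv (C := δ * c)
    (fun s hs => (hpow s hs).continuousAt.continuousWithinAt)
    (fun s hs => (hpow s (interior_subset hs)).differentiableAt.differentiableWithinAt)
    (fun s hs => by
      have hs := interior_subset hs
      have hcancel : f s ^ (δ + 1) * f s ^ (-δ - 1) = 1 := by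
        rw [← Real.rpow_add (hpos s hs), show δ + 1 + (-δ - 1) = 0 by ring, Real.rpow_zero]
      have := Real.rpow_pos_of_pos (hpos s hs) (-δ - 1)
      rw [(hpow s hs).deriv]
      calc δ * c = δ * (c * f s ^ (δ + 1)) * f s ^ (-δ - 1) := by
            rw [mul_assoc, mul_assoc c, hcancel, mul_one]
        _ ≤ δ * -deriv f s * f s ^ (-δ - 1) := by
            gcongr
            linarith [hd s hs]
        _ = deriv f s * (-δ) * f s ^ (-δ - 1) := by ring) R self_mem_Ici r hr hr
  have := Real.rpow_pos_of_pos (hpos R le_rfl) (-δ)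
  linarith

end Comparison

section Decay

variable {p q m s : ℝ}

/-- A radius beyond which every profile with `2q + 1 < m` is at most `1`: as long as `u ≥ 1`, the
derivative of `X^(1-1/p) ∈ [0, 1)`, where `X` is the deficit of `u`, exceeds its inverse. -/
noncomputable def unitRadius (p q : ℝ) : ℝ := ((1 - 1 / p) * (kappa p q * ((q + 1) / 2)))⁻¹

/-- The constant `c` in `-u' ≥ c u^((q+1)/p)`, valid where `u ≤ 1`. -/
noncomputable def decayRate (p q : ℝ) : ℝ := kappa p q * (1 / 2) ^ (1 / p)

/-- The constant `D` in `D r ≤ u^(-((q+1)/p-1))`, valid for `r ≥ 2 * unitRadius p q`. -/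
noncomputable def algebraicRate (p q : ℝ) : ℝ := ((q + 1) / p - 1) * decayRate p q / 2

/-- The prefactor of the algebraic decay. -/
noncomputable def decayConst (p q : ℝ) : ℝ :=
  (1 + kappa p q * (algebraicRate p q)⁻¹) * algebraicRate p q ^ (-(p / (q + 1 - p)))

lemma unitRadius_pos (hp : 1 < p) (hq : 0 < q + 1) : 0 < unitRadius p q :=
  inv_pos.2 (mul_pos (one_sub_one_div_mem hp).1 (mul_pos (kappa_pos hp hq) (half_pos hq)))

lemma decayRate_pos (hp : 1 < p) (hq : 0 < q + 1) : 0 < decayRate p q :=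
  mul_pos (kappa_pos hp hq) (by positivity)

lemma algebraicRate_pos (hp : 1 < p) (hqp : p - 1 < q) : 0 < algebraicRate p q := by
  have hδ : 0 < (q + 1) / p - 1 := sub_pos.2 ((one_lt_div (by positivity)).2 (by linarith))
  exact half_pos (mul_pos hδ (decayRate_pos hp (by linarith)))

lemma decayConst_pos (hp : 1 < p) (hqp : p - 1 < q) : 0 < decayConst p q := by
  have := kappa_pos hp (show 0 < q + 1 by linarith)
  have := algebraicRate_pos hp hqp
  unfold decayConst
  positivity

lemma half_le_mul_one_sub_deficit (hq : 0 < q + 1) (hm : 2 * q + 1 < m) (hs : 1 ≤ s) :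
    (q + 1) / 2 ≤ (m - q) * (1 - deficit q m s) := by
  have hmq : 0 < m - q := by linarith
  have hm1 : 0 < m + 1 := by linarith
  have hle := le_mul_of_one_le_left (div_pos hq hm1).le (Real.one_le_rpow hs hmq.le)
  rw [one_sub_deficit_eq hq (by linarith) (zero_le_one.trans hs)]
  refine le_trans ?_ (mul_le_mul_of_nonneg_left hle hmq.le)
  rw [← mul_div_assoc, div_le_div_iff₀ two_pos hm1]
  nlinarith

lemma inv_unitRadius_le (hp : 1 < p) (hqp : p - 1 ≤ q) (hm : 2 * q + 1 < m) (hs : 1 ≤ s) :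
    (unitRadius p q)⁻¹ ≤ (1 - 1 / p) *
      (kappa p q * ((m - q) * (1 - deficit q m s)) * s ^ ((q + 1) / p - 1)) := by
  have hq : 0 < q + 1 := by linarith
  have hk := kappa_pos hp hq
  have hpow : 1 ≤ s ^ ((q + 1) / p - 1) :=
    Real.one_le_rpow hs (sub_nonneg.2 ((one_le_div (by positivity)).2 (by linarith)))
  have hhalf := half_le_mul_one_sub_deficit hq hm hs
  have hkhalf := mul_le_mul_of_nonneg_left hhalf hk.le
  rw [unitRadius, inv_inv]
  refine mul_le_mul_of_nonneg_left (hkhalf.trans ?_) (one_sub_one_div_mem hp).1.le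
  exact le_mul_of_one_le_right ((by positivity : 0 ≤ kappa p q * ((q + 1) / 2)).trans hkhalf) hpow

lemma half_le_deficit (hq : 0 < q + 1) (hm : 2 * q + 1 < m) (hs : 0 ≤ s) (hs1 : s ≤ 1) :
    1 / 2 ≤ deficit q m s := by
  have hle := mul_le_of_le_one_left (by apply div_nonneg <;> linarith : 0 ≤ (q + 1) / (m + 1))
    (Real.rpow_le_one hs hs1 (by linarith : 0 ≤ m - q))
  rw [← one_sub_deficit_eq hq (by linarith) hs] at hle
  have hhalf : (q + 1) / (m + 1) ≤ 1 / 2 := by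
    rw [div_le_div_iff₀ (by linarith) two_pos]
    linarith
  linarith

namespace IsProfile

variable {u : ℝ → ℝ} {r : ℝ}

lemma hasDerivAt_deficit_rpow (h : IsProfile p q m u) (hp : 1 < p) (hq : 0 < q + 1) (hm : q < m)
    (hr : 0 < r) :
    HasDerivAt (fun r => deficit q m (u r) ^ (1 - 1 / p)) ((1 - 1 / p) *
      (kappa p q * ((m - q) * (1 - deficit q m (u r))) * u r ^ ((q + 1) / p - 1))) r := by
  have hX := (h.deficit_mem hq hm hr).1
  have hu := h.pos r hr.le
  refine ((h.hasDerivAt_deficit hq hm hr).rpow_const (Or.inl hX.ne')).congr_deriv ?_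
  rw [speed_eq hp hq hm hu.le (h.lt_peak r hr).le, show 1 - 1 / p - 1 = -(1 / p) by ring,
    Real.rpow_neg hX.le, Real.rpow_sub_one hu.ne']
  have := (Real.rpow_pos_of_pos hX (1 / p)).ne'
  generalize 1 - 1 / p = a
  field_simp

lemma le_one (h : IsProfile p q m u) (hp : 1 < p) (hqp : p - 1 ≤ q) (hm : 2 * q + 1 < m)
    (hr : unitRadius p q ≤ r) : u r ≤ 1 := by
  have hq : 0 < q + 1 := by linarith
  have hqm : q < m := by linarith
  have hr0 : 0 < r := (unitRadius_pos hp hq).trans_le hr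
  have ha := (one_sub_one_div_mem hp).1
  by_contra! hlt
  have hge : ∀ s ∈ Ioo 0 r, 1 ≤ u s := fun s hs => hlt.le.trans
    ((h.strictAntiOn hp hq hqm).antitoneOn hs.1.le hr0.le hs.2.le)
  have hd := fun s (hs : s ∈ Ioo 0 r) => h.hasDerivAt_deficit_rpow hp hq hqm hs.1
  have hmv := (convex_Icc 0 r).mul_sub_le_image_sub_of_le_deriv (C := (unitRadius p q)⁻¹)
    (((h.continuousOn_deficit hq hqm).rpow_const fun _ _ => Or.inr ha.le).mono
      Icc_subset_Ici_self)
    (by rw [interior_Icc]; exact fun s hs => (hd s hs).differentiableAt.differentiableWithinAt)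
    (by
      rw [interior_Icc]
      intro s hs
      rw [(hd s hs).deriv]
      exact inv_unitRadius_le hp hqp hm (hge s hs))
    0 ⟨le_rfl, hr0.le⟩ r ⟨hr0.le, le_rfl⟩ hr0.le
  have hend : deficit q m (u r) ^ (1 - 1 / p) < 1 :=
    Real.rpow_lt_one (h.deficit_mem hq hqm hr0).1.le (h.deficit_mem hq hqm hr0).2 ha
  have hrise : 1 ≤ (unitRadius p q)⁻¹ * r := by
    rwa [inv_mul_eq_div, one_le_div (unitRadius_pos hp hq)]
  rw [h.deficit_apply_zero hq hqm, Real.zero_rpow ha.ne'] at hmv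
  linarith

lemma deriv_le (h : IsProfile p q m u) (hp : 1 < p) (hqp : p - 1 ≤ q) (hm : 2 * q + 1 < m)
    (hr : unitRadius p q ≤ r) : deriv u r ≤ -decayRate p q * u r ^ ((q + 1) / p) := by
  have hq : 0 < q + 1 := by linarith
  have hr0 : 0 < r := (unitRadius_pos hp hq).trans_le hr
  have hu := (h.pos r hr0.le).le
  have hhalf := half_le_deficit hq hm hu (h.le_one hp hqp hm hr)
  have hk := kappa_pos hp hq
  rw [h.deriv_eq hr0, neg_mul, neg_le_neg_iff, speed_eq hp hq (by linarith) hu (h.lt_peak r hr0).le,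
    decayRate, mul_right_comm]
  gcongr

lemma exp_decay (h : IsProfile p q m u) (hp : 1 < p) (hqp : q = p - 1) (hm : 2 * q + 1 < m)
    (hr : 2 * unitRadius p q ≤ r) : u r ≤ Real.exp (-(decayRate p q / 2 * r)) := by
  have hq : 0 < q + 1 := by linarith
  have hR := unitRadius_pos hp hq
  have hexp : (q + 1) / p = 1 := by rw [hqp, sub_add_cancel, div_self (by positivity)]
  have hle := le_mul_exp_of_deriv_le
    (fun s hs => (h.hasDerivAt s (hR.trans_le hs)).differentiableAt)
    (fun s hs => h.pos s (hR.le.trans hs))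
    (fun s hs => by simpa only [hexp, Real.rpow_one] using h.deriv_le hp hqp.ge hm hs)
    (by linarith : unitRadius p q ≤ r)
  have hstart := mul_le_of_le_one_left (Real.exp_pos (-decayRate p q * (r - unitRadius p q))).le
    (h.le_one hp hqp.ge hm le_rfl)
  refine (hle.trans hstart).trans (Real.exp_le_exp.2 ?_)
  nlinarith [decayRate_pos hp hq]

lemma algebraicRate_mul_le (h : IsProfile p q m u) (hp : 1 < p) (hqp : p - 1 ≤ q)
    (hm : 2 * q + 1 < m) (hr : 2 * unitRadius p q ≤ r) :
    algebraicRate p q * r ≤ u r ^ (-((q + 1) / p - 1)) := by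
  have hq : 0 < q + 1 := by linarith
  have hR := unitRadius_pos hp hq
  have hδ : 0 ≤ (q + 1) / p - 1 :=
    sub_nonneg.2 ((one_le_div (by positivity)).2 (by linarith))
  have hle := mul_sub_le_rpow_neg_of_deriv_le hδ
    (fun s hs => (h.hasDerivAt s (hR.trans_le hs)).differentiableAt)
    (fun s hs => h.pos s (hR.le.trans hs))
    (fun s hs => by simpa only [sub_add_cancel] using h.deriv_le hp hqp hm hs)
    (by linarith : unitRadius p q ≤ r)
  have := mul_nonneg hδ (decayRate_pos hp hq).le
  rw [algebraicRate]
  nlinarith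

lemma le_rpow (h : IsProfile p q m u) (hp : 1 < p) (hqp : p - 1 < q) (hm : 2 * q + 1 < m)
    (hr : 2 * unitRadius p q ≤ r) : u r ≤ (algebraicRate p q * r) ^ (-(p / (q + 1 - p))) := by
  have hr0 : 0 < r := by linarith [unitRadius_pos hp (by linarith : 0 < q + 1)]
  have hu := h.pos r hr0.le
  have hexp : -((q + 1) / p - 1) * -(p / (q + 1 - p)) = 1 := by
    have : q + 1 - p ≠ 0 := by linarith
    field_simp
  calc u r = (u r ^ (-((q + 1) / p - 1))) ^ (-(p / (q + 1 - p))) := by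
        rw [← Real.rpow_mul hu.le, hexp, Real.rpow_one]
    _ ≤ _ := Real.rpow_le_rpow_of_nonpos (mul_pos (algebraicRate_pos hp hqp) hr0)
        (h.algebraicRate_mul_le hp hqp.le hm hr)
        (neg_nonpos.2 (div_nonneg (by positivity) (by linarith)))

lemma mul_abs_deriv_le (h : IsProfile p q m u) (hp : 1 < p) (hqp : p - 1 < q)
    (hm : 2 * q + 1 < m) (hr : 2 * unitRadius p q ≤ r) :
    r * |deriv u r| ≤ kappa p q * (algebraicRate p q)⁻¹ * u r := by
  have hq : 0 < q + 1 := by linarith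
  have hqm : q < m := by linarith
  have hr0 : 0 < r := by linarith [unitRadius_pos hp hq]
  have hu := h.pos r hr0.le
  have hk := kappa_pos hp hq
  have hD := algebraicRate_pos hp hqp
  have hX := h.deficit_mem hq hqm hr0
  have hX1 : deficit q m (u r) ^ (1 / p) ≤ 1 := Real.rpow_le_one hX.1.le hX.2.le (by positivity)
  have hX0 := Real.rpow_nonneg hX.1.le (1 / p)
  have hpow : u r ^ ((q + 1) / p - 1) ≤ (algebraicRate p q * r)⁻¹ := by
    rw [le_inv_comm₀ (Real.rpow_pos_of_pos hu _) (by positivity), ← Real.rpow_neg hu.le]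
    exact h.algebraicRate_mul_le hp hqp.le hm hr
  calc r * |deriv u r|
      = r * (kappa p q * (u r ^ ((q + 1) / p - 1) * u r) * deficit q m (u r) ^ (1 / p)) := by
        rw [h.abs_deriv hp hq hqm hr0, speed_eq hp hq hqm hu.le (h.lt_peak r hr0).le,
          ← Real.rpow_add_one hu.ne', sub_add_cancel]
    _ ≤ r * (kappa p q * ((algebraicRate p q * r)⁻¹ * u r) * 1) := by gcongr
    _ = kappa p q * (algebraicRate p q)⁻¹ * u r := by field_simp

lemma algebraic_decay (h : IsProfile p q m u) (hp : 1 < p) (hqp : p - 1 < q)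
    (hm : 2 * q + 1 < m) (hr : 2 * unitRadius p q ≤ r) :
    u r + r * |deriv u r| ≤ decayConst p q * r ^ (-(p / (q + 1 - p))) := by
  have hq : 0 < q + 1 := by linarith
  have hr0 : 0 < r := by linarith [unitRadius_pos hp hq]
  have hk := kappa_pos hp hq
  have hD := algebraicRate_pos hp hqp
  calc u r + r * |deriv u r| ≤ (1 + kappa p q * (algebraicRate p q)⁻¹) * u r := by
        linarith [h.mul_abs_deriv_le hp hqp hm hr]
    _ ≤ (1 + kappa p q * (algebraicRate p q)⁻¹) *
          (algebraicRate p q * r) ^ (-(p / (q + 1 - p))) := by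
        gcongr
        exact h.le_rpow hp hqp hm hr
    _ = decayConst p q * r ^ (-(p / (q + 1 - p))) := by
        rw [Real.mul_rpow hD.le hr0.le, decayConst]
        ring

end IsProfile

end Decay

section Integrability

variable {α : Type*} [MeasurableSpace α] {μ : Measure α} {f : α → ℝ} {q m s M : ℝ}

lemma rpow_add_one_le (hq : 0 < q + 1) (hm : q < m) (hs : 0 ≤ s) (hle : s ≤ M) :
    s ^ (m + 1) ≤ M ^ (m - q) * s ^ (q + 1) := by
  have hsplit : s ^ (m + 1) = s ^ (m - q) * s ^ (q + 1) := by
    rw [← Real.rpow_add_of_nonneg hs (sub_pos.2 hm).le hq.le]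
    ring_nf
  rw [hsplit]
  have := sub_pos.2 hm
  gcongr

lemma integrable_rpow_add_one (hf : AEStronglyMeasurable f μ) (hq : 0 < q + 1) (hm : q < m)
    (hf0 : ∀ᵐ x ∂μ, 0 ≤ f x) (hfM : ∀ᵐ x ∂μ, f x ≤ M)
    (hfi : Integrable (fun x => f x ^ (q + 1)) μ) : Integrable (fun x => f x ^ (m + 1)) μ := by
  refine (hfi.const_mul (M ^ (m - q))).mono'
    (hf.aemeasurable.pow_const (m + 1)).aestronglyMeasurable ?_
  filter_upwards [hf0, hfM] with x hx0 hxM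
  rw [Real.norm_of_nonneg (Real.rpow_nonneg hx0 _)]
  exact rpow_add_one_le hq hm hx0 hxM

lemma memLp_ofReal_iff (hf : AEStronglyMeasurable f μ) (hs : 0 < s) :
    MemLp f (ENNReal.ofReal s) μ ↔ Integrable (fun x => |f x| ^ s) μ := by
  simpa only [ENNReal.toReal_ofReal hs.le, Real.norm_eq_abs] using
    (integrable_norm_rpow_iff hf (ENNReal.ofReal_pos.2 hs).ne' ENNReal.ofReal_ne_top).symm

end Integrability

section EvenExtension

variable {f u : ℝ → ℝ} {x : ℝ}

lemma integrable_comp_abs (hf : IntegrableOn f (Ioi 0)) : Integrable fun x => f |x| := by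
  have hpos : IntegrableOn (fun x => f |x|) (Ioi 0) :=
    hf.congr_fun (fun x hx => by rw [abs_of_pos hx]) measurableSet_Ioi
  have hneg : IntegrableOn (fun x => f |x|) (Iio 0) := by
    rw [← neg_zero] at hpos
    simpa only [abs_neg] using hpos.comp_neg_Iio (f := fun x => f |x|)
  rw [← integrableOn_univ, ← Iic_union_Ioi (a := (0 : ℝ))]
  exact ((integrableOn_Iic_iff_integrableOn_Iio (by simp)).2 hneg).union hpos

lemma hasDerivAt_comp_abs_zero (hu : HasDerivWithinAt u 0 (Ici 0) 0) :
    HasDerivAt (fun x => u |x|) 0 0 := by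
  have hright : HasDerivWithinAt (fun x => u |x|) 0 (Ici 0) 0 :=
    hu.congr (fun x hx => by rw [abs_of_nonneg hx]) (by rw [abs_zero])
  have hleft : HasDerivWithinAt (fun x => u |x|) 0 (Iic 0) 0 := by
    have hright' : HasDerivWithinAt (fun x => u |x|) 0 (Ici 0) (-0) := by rwa [neg_zero]
    simpa only [Function.comp_def, abs_neg, zero_mul] using
      hright'.comp (0 : ℝ) (hasDerivWithinAt_neg 0 (Iic 0)) fun x hx => neg_nonneg.2 hx
  have hunion := hright.union hleft
  rwa [union_comm, Iic_union_Ici, hasDerivWithinAt_univ] at hunion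

lemma hasDerivAt_comp_abs (hu : DifferentiableAt ℝ u |x|) (hx : x ≠ 0) :
    HasDerivAt (fun x => u |x|) (deriv u |x| * SignType.sign x) x :=
  hu.hasDerivAt.comp x (hasDerivAt_abs hx)

lemma abs_deriv_comp_abs (hu : DifferentiableAt ℝ u |x|) (hx : x ≠ 0) :
    |deriv (fun x => u |x|) x| = |deriv u (|x|)| := by
  rw [(hasDerivAt_comp_abs hu hx).deriv, abs_mul]
  rcases hx.lt_or_gt with hneg | hpos
  · simp [sign_neg hneg]
  · simp [sign_pos hpos]

end EvenExtension

section ProfileIntegrals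

namespace IsProfile

variable {p q m : ℝ} {u H : ℝ → ℝ}

lemma continuousWithinAt_comp (h : IsProfile p q m u) (hH : Continuous H) :
    ContinuousWithinAt (fun r => H (u r)) (Ici 0) 0 :=
  hH.continuousAt.comp_continuousWithinAt h.continuousWithinAt_zero

lemma aestronglyMeasurable (h : IsProfile p q m u) :
    AEStronglyMeasurable u (volume.restrict (Ioi 0)) :=
  (h.continuousOn.mono Ioi_subset_Ici_self).aestronglyMeasurable measurableSet_Ioi

lemma le_peak (h : IsProfile p q m u) {r : ℝ} (hr : 0 ≤ r) : u r ≤ peak q m := by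
  rcases hr.eq_or_lt with rfl | hr
  · exact h.apply_zero.le
  · exact (h.lt_peak r hr).le

lemma hasDerivAt_primitive_comp (h : IsProfile p q m u) (hH : Continuous H) {r : ℝ}
    (hr : 0 < r) :
    HasDerivAt (fun r => -∫ s in (0 : ℝ)..u r, H s) (speed p q m (u r) * H (u r)) r :=
  (((hH.integral_hasStrictDerivAt 0 (u r)).hasDerivAt.comp r (h.hasDerivAt r hr)).neg).congr_deriv
    (by ring)

lemma tendsto_primitive_comp (h : IsProfile p q m u) (hH : Continuous H) :
    Tendsto (fun r => -∫ s in (0 : ℝ)..u r, H s) atTop (𝓝 0) := by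
  have hlim := ((intervalIntegral.continuous_primitive
    (fun a b => hH.intervalIntegrable (μ := volume) a b) 0).tendsto 0).comp
    h.tendsto_zero
  simpa using hlim.neg

lemma continuousWithinAt_primitive_comp (h : IsProfile p q m u) (hH : Continuous H) :
    ContinuousWithinAt (fun r => -∫ s in (0 : ℝ)..u r, H s) (Ici 0) 0 :=
  (h.continuousWithinAt_comp (H := fun x => ∫ s in (0 : ℝ)..x, H s)
    (intervalIntegral.continuous_primitive (fun a b => hH.intervalIntegrable a b) 0)).neg

lemma integrableOn_speed_mul_comp (h : IsProfile p q m u) (hp : 1 < p) (hq : 0 < q + 1)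
    (hm : q < m) (hH : Continuous H) (hH0 : ∀ s ∈ Ioo 0 (peak q m), 0 ≤ H s) :
    IntegrableOn (fun r => speed p q m (u r) * H (u r)) (Ioi 0) :=
  integrableOn_Ioi_deriv_of_nonneg (h.continuousWithinAt_primitive_comp hH)
    (fun _ hr => h.hasDerivAt_primitive_comp hH hr)
    (fun r hr => mul_nonneg (h.speed_pos hp hq hm hr).le
      (hH0 _ ⟨h.pos r (le_of_lt hr), h.lt_peak r hr⟩))
    (h.tendsto_primitive_comp hH)

lemma integral_speed_mul_comp (h : IsProfile p q m u) (hp : 1 < p) (hq : 0 < q + 1)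
    (hm : q < m) (hH : Continuous H) (hH0 : ∀ s ∈ Ioo 0 (peak q m), 0 ≤ H s) :
    ∫ r in Ioi 0, speed p q m (u r) * H (u r) = ∫ s in (0 : ℝ)..peak q m, H s := by
  rw [integral_Ioi_of_hasDerivAt_of_tendsto (h.continuousWithinAt_primitive_comp hH)
    (fun _ hr => h.hasDerivAt_primitive_comp hH hr) (h.integrableOn_speed_mul_comp hp hq hm hH hH0)
    (h.tendsto_primitive_comp hH), h.apply_zero, zero_sub, neg_neg]

lemma rpow_le_mul_speed (h : IsProfile p q m u) (hp : 1 < p) (hq : 0 < q + 1) (hm : q < m)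
    {r : ℝ} (hr : 1 < r) :
    u r ^ (q + 1) ≤ (kappa p q * deficit q m (u 1) ^ (1 / p))⁻¹ *
      (speed p q m (u r) * u r ^ ((q + 1) * (1 - 1 / p))) := by
  have hr0 : 0 < r := one_pos.trans hr
  have hu := h.pos r hr0.le
  have hdeficit : deficit q m (u 1) ≤ deficit q m (u r) := by
    have hlt := h.strictAntiOn hp hq hm (mem_Ici.2 zero_le_one) (mem_Ici.2 hr0.le) hr
    have := peak_pos hq hm
    have := sub_pos.2 hm
    unfold deficit
    gcongr
  have hdeficit_pos : 0 < deficit q m (u 1) := (h.deficit_mem hq hm one_pos).1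
  have hkappa := kappa_pos hp hq
  have hsplit : u r ^ (q + 1) = u r ^ ((q + 1) / p) * u r ^ ((q + 1) * (1 - 1 / p)) := by
    rw [← Real.rpow_add hu]
    ring_nf
  rw [inv_mul_eq_div, le_div_iff₀ (by positivity), hsplit,
    speed_eq hp hq hm hu.le (h.le_peak hr0.le)]
  calc u r ^ ((q + 1) / p) * u r ^ ((q + 1) * (1 - 1 / p)) *
        (kappa p q * deficit q m (u 1) ^ (1 / p))
      ≤ u r ^ ((q + 1) / p) * u r ^ ((q + 1) * (1 - 1 / p)) *
        (kappa p q * deficit q m (u r) ^ (1 / p)) := by gcongr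
    _ = _ := by ring

lemma integrableOn_rpow (h : IsProfile p q m u) (hp : 1 < p) (hq : 0 < q + 1) (hm : q < m) :
    IntegrableOn (fun r => u r ^ (q + 1)) (Ioi 0) := by
  have he : 0 ≤ (q + 1) * (1 - 1 / p) := mul_nonneg hq.le (one_sub_one_div_mem hp).1.le
  have hcont : ContinuousOn (fun r => u r ^ (q + 1)) (Ici 0) :=
    h.continuousOn.rpow_const fun _ _ => Or.inr hq.le
  have htail : IntegrableOn (fun r => u r ^ (q + 1)) (Ioi 1) := by
    have hmajorant := (h.integrableOn_speed_mul_comp hp hq hm (Real.continuous_rpow_const he)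
      fun s hs => Real.rpow_nonneg hs.1.le _).mono_set (Ioi_subset_Ioi zero_le_one)
    refine (hmajorant.const_mul (kappa p q * deficit q m (u 1) ^ (1 / p))⁻¹).mono'
      ((hcont.mono fun r (hr : 1 < r) => mem_Ici.2
        (zero_le_one.trans hr.le)).aestronglyMeasurable measurableSet_Ioi) ?_
    filter_upwards [ae_restrict_mem measurableSet_Ioi] with r hr
    rw [Real.norm_of_nonneg (Real.rpow_nonneg (h.pos r (zero_le_one.trans (le_of_lt hr))).le _)]
    exact h.rpow_le_mul_speed hp hq hm hr
  rw [← Ioc_union_Ioi_eq_Ioi zero_le_one]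
  exact ((hcont.mono Icc_subset_Ici_self).integrableOn_Icc.mono_set Ioc_subset_Icc_self).union htail

lemma integrableOn_rpow_add_one (h : IsProfile p q m u) (hp : 1 < p) (hq : 0 < q + 1)
    (hm : q < m) : IntegrableOn (fun r => u r ^ (m + 1)) (Ioi 0) :=
  integrable_rpow_add_one h.aestronglyMeasurable hq hm
    ((ae_restrict_mem measurableSet_Ioi).mono fun r hr => (h.pos r (le_of_lt hr)).le)
    ((ae_restrict_mem measurableSet_Ioi).mono fun r hr => (h.lt_peak r hr).le)
    (h.integrableOn_rpow hp hq hm)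

lemma abs_deriv_rpow (h : IsProfile p q m u) (hp : 1 < p) (hq : 0 < q + 1) (hm : q < m) {r : ℝ}
    (hr : 0 < r) : |deriv u r| ^ p = p / (p - 1) * potential q m (u r) := by
  rw [h.abs_deriv hp hq hm hr,
    speed_rpow hp (potential_pos hq hm (h.pos r hr.le) (h.lt_peak r hr)).le,
    div_self (by positivity), Real.rpow_one]

lemma abs_deriv_rpow_eq_mul (h : IsProfile p q m u) (hp : 1 < p) (hq : 0 < q + 1) (hm : q < m)
    {r : ℝ} (hr : 0 < r) :
    |deriv u r| ^ p = speed p q m (u r) * speed p q m (u r) ^ (p - 1) := by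
  rw [h.abs_deriv hp hq hm hr, ← Real.rpow_one_add' (h.speed_pos hp hq hm hr).le (by linarith),
    add_sub_cancel]

lemma integrableOn_abs_deriv_rpow (h : IsProfile p q m u) (hp : 1 < p) (hq : 0 < q + 1)
    (hm : q < m) : IntegrableOn (fun r => |deriv u r| ^ p) (Ioi 0) :=
  (h.integrableOn_speed_mul_comp hp hq hm (continuous_speed_rpow hp hq hm)
    fun _ hs => speed_rpow_nonneg hp hq hm hs).congr_fun
    (fun _ hr => (h.abs_deriv_rpow_eq_mul hp hq hm hr).symm) measurableSet_Ioi

lemma integral_abs_deriv_rpow (h : IsProfile p q m u) (hp : 1 < p) (hq : 0 < q + 1)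
    (hm : q < m) :
    ∫ r in Ioi 0, |deriv u r| ^ p = ∫ s in (0 : ℝ)..peak q m, speed p q m s ^ (p - 1) := by
  rw [← h.integral_speed_mul_comp hp hq hm (continuous_speed_rpow hp hq hm)
    fun _ hs => speed_rpow_nonneg hp hq hm hs]
  exact setIntegral_congr_fun measurableSet_Ioi fun _ hr => h.abs_deriv_rpow_eq_mul hp hq hm hr

lemma integral_energy (h : IsProfile p q m u) (hp : 1 < p) (hq : 0 < q + 1) (hm : q < m) :
    ∫ r in Ioi 0, |deriv u r| ^ p = p / (p - 1) *
      ((∫ r in Ioi 0, u r ^ (q + 1)) / (q + 1) - (∫ r in Ioi 0, u r ^ (m + 1)) / (m + 1)) := by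
  rw [setIntegral_congr_fun measurableSet_Ioi fun r hr => h.abs_deriv_rpow hp hq hm hr]
  simp only [potential]
  rw [integral_const_mul, integral_sub ((h.integrableOn_rpow hp hq hm).div_const _)
    ((h.integrableOn_rpow_add_one hp hq hm).div_const _), integral_div, integral_div]

/- The equation tested with the solution: the integrand below is the derivative of
`|u'|^(p-1) u`, which vanishes at both ends. -/
lemma integral_nehari (h : IsProfile p q m u) (hp : 1 < p) (hq : 0 < q + 1) (hm : q < m) :
    ∫ r in Ioi 0, |deriv u r| ^ p =
      (∫ r in Ioi 0, u r ^ (m + 1)) - ∫ r in Ioi 0, u r ^ (q + 1) := by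
  have hmass := h.integrableOn_rpow hp hq hm
  have hpower := h.integrableOn_rpow_add_one hp hq hm
  have hkinetic := h.integrableOn_abs_deriv_rpow hp hq hm
  have hcont := (continuous_speed_rpow hp hq hm).mul continuous_id
  have hderiv : ∀ r ∈ Ioi (0 : ℝ), HasDerivAt (fun r => speed p q m (u r) ^ (p - 1) * u r)
      (u r ^ (m + 1) - u r ^ (q + 1) - |deriv u r| ^ p) r := by
    intro r hr
    have hu := (h.pos r (le_of_lt hr)).ne'
    refine ((h.hasDerivAt_speed_rpow hp hq hm hr).mul (h.hasDerivAt r hr)).congr_deriv ?_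
    rw [h.abs_deriv_rpow_eq_mul hp hq hm hr, sub_mul, ← Real.rpow_add_one hu,
      ← Real.rpow_add_one hu]
    ring
  have htotal := integral_Ioi_of_hasDerivAt_of_tendsto (h.continuousWithinAt_comp hcont) hderiv
    ((hpower.sub hmass).sub hkinetic) ((hcont.tendsto 0).comp h.tendsto_zero)
  rw [integral_sub (f := fun r => u r ^ (m + 1) - u r ^ (q + 1)) (hpower.sub hmass) hkinetic,
    integral_sub hpower hmass] at htotal
  simp only [Pi.mul_apply, id_eq, mul_zero, h.apply_zero, speed_peak hp hq hm,
    Real.zero_rpow (sub_pos.2 hp).ne', zero_mul, sub_zero] at htotal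
  exact (sub_eq_zero.1 htotal).symm

lemma differentiable_comp_abs (h : IsProfile p q m u) (hp : 1 < p) (hq : 0 < q + 1)
    (hm : q < m) : Differentiable ℝ fun x => u |x| := by
  intro x
  rcases eq_or_ne x 0 with rfl | hx
  · exact (hasDerivAt_comp_abs_zero (h.hasDerivWithinAt_zero hp hq hm)).differentiableAt
  · exact (hasDerivAt_comp_abs (h.hasDerivAt _ (abs_pos.2 hx)).differentiableAt
      hx).differentiableAt

lemma abs_comp_abs (h : IsProfile p q m u) (x : ℝ) : |u (|x|)| = u |x| :=
  abs_of_pos (h.pos _ (abs_nonneg x))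

lemma ae_abs_deriv_comp_abs (h : IsProfile p q m u) :
    (fun x => |deriv u (|x|)| ^ p) =ᵐ[volume] fun x => |deriv (fun x => u |x|) x| ^ p := by
  filter_upwards [Measure.ae_ne volume 0] with x hx
  rw [abs_deriv_comp_abs (h.hasDerivAt _ (abs_pos.2 hx)).differentiableAt hx]

lemma memX (h : IsProfile p q m u) (hp : 1 < p) (hq : 0 < q + 1) (hm : q < m) :
    MemX p q (fun x => u |x|) (deriv fun x => u |x|) := by
  have hdiff := h.differentiable_comp_abs hp hq hm
  have hv : MemLp (fun x => u |x|) (ENNReal.ofReal (q + 1)) := by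
    rw [memLp_ofReal_iff hdiff.continuous.aestronglyMeasurable hq]
    simp only [h.abs_comp_abs]
    exact integrable_comp_abs (f := fun r => u r ^ (q + 1)) (h.integrableOn_rpow hp hq hm)
  have hg : MemLp (deriv fun x => u |x|) (ENNReal.ofReal p) := by
    rw [memLp_ofReal_iff (measurable_deriv _).aestronglyMeasurable (by positivity)]
    exact (integrable_comp_abs (f := fun r => |deriv u r| ^ p)
      (h.integrableOn_abs_deriv_rpow hp hq hm)).congr h.ae_abs_deriv_comp_abs
  have hgl : LocallyIntegrable (deriv fun x => u |x|) volume :=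
    hg.locallyIntegrable (ENNReal.one_le_ofReal.2 hp.le)
  refine ⟨hv, hg, hdiff.continuous.locallyIntegrable, hgl, fun φ hφ hφc => ?_⟩
  have hφd : Differentiable ℝ φ := hφ.differentiable (by simp)
  have hφ' : Continuous (deriv φ) := hφ.continuous_deriv (by simp)
  exact integral_mul_deriv_eq_deriv_mul_of_integrable
    (fun x _ => (hdiff x).hasDerivAt) (fun x _ => (hφd x).hasDerivAt)
    ((hdiff.continuous.mul hφ').integrable_of_hasCompactSupport hφc.deriv.mul_left)
    (hgl.integrable_smul_right_of_hasCompactSupport hφ.continuous hφc)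
    ((hdiff.continuous.mul hφ.continuous).integrable_of_hasCompactSupport hφc.mul_left)

end IsProfile

end ProfileIntegrals

section WeakDerivatives

lemma absolutelyContinuousOnInterval_comp {f G : ℝ → ℝ} {a b : ℝ} {K : NNReal} {s : Set ℝ}
    (hG : LipschitzOnWith K G s) (hf : AbsolutelyContinuousOnInterval f a b)
    (hs : MapsTo f (uIcc a b) s) : AbsolutelyContinuousOnInterval (fun x => G (f x)) a b := by
  rw [absolutelyContinuousOnInterval_iff] at hf ⊢
  intro ε hε
  obtain ⟨δ, hδ, hsum⟩ := hf (ε / (K + 1)) (by positivity)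
  refine ⟨δ, hδ, fun E hE hlength => ?_⟩
  calc ∑ i ∈ Finset.range E.1, dist (G (f (E.2 i).1)) (G (f (E.2 i).2))
      ≤ ∑ i ∈ Finset.range E.1, K * dist (f (E.2 i).1) (f (E.2 i).2) :=
        Finset.sum_le_sum fun i hi => hG.dist_le_mul _ (hs (hE.1 i hi).1) _ (hs (hE.1 i hi).2)
    _ = K * ∑ i ∈ Finset.range E.1, dist (f (E.2 i).1) (f (E.2 i).2) := by rw [Finset.mul_sum]
    _ ≤ K * (ε / (K + 1)) := mul_le_mul_of_nonneg_left (hsum E hE hlength).le K.2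
    _ < (K + 1) * (ε / (K + 1)) := by gcongr; linarith
    _ = ε := by field_simp

/-- `w` is a primitive of the locally integrable function `g`; these are the continuous
representatives of the functions with weak derivative `g`. -/
structure IsLebesguePrimitive (w g : ℝ → ℝ) : Prop where
  locallyIntegrable : LocallyIntegrable g volume
  sub_eq_integral : ∀ x y, w y - w x = ∫ t in x..y, g t

variable {w g : ℝ → ℝ}

lemma isLebesguePrimitive_integral (hg : LocallyIntegrable g volume) (c : ℝ) :
    IsLebesguePrimitive (fun x => c + ∫ t in (0 : ℝ)..x, g t) g := by
  have hi : ∀ a b, IntervalIntegrable g volume a b := fun a b =>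
    (hg.integrableOn_isCompact isCompact_uIcc).intervalIntegrable
  refine ⟨hg, fun x y => ?_⟩
  rw [add_sub_add_left_eq_sub, intervalIntegral.integral_interval_sub_left (hi _ _) (hi _ _)]

namespace IsLebesguePrimitive

lemma intervalIntegrable (h : IsLebesguePrimitive w g) (a b : ℝ) :
    IntervalIntegrable g volume a b :=
  (h.locallyIntegrable.integrableOn_isCompact isCompact_uIcc).intervalIntegrable

lemma eq_add (h : IsLebesguePrimitive w g) (a : ℝ) : w = fun x => w a + ∫ t in a..x, g t := by
  ext x
  rw [← h.sub_eq_integral a x, add_sub_cancel]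

lemma continuous (h : IsLebesguePrimitive w g) : Continuous w := by
  rw [h.eq_add 0]
  exact continuous_const.add (intervalIntegral.continuous_primitive h.intervalIntegrable 0)

lemma absolutelyContinuousOnInterval (h : IsLebesguePrimitive w g) (a b : ℝ) :
    AbsolutelyContinuousOnInterval w a b := by
  have hprimitive := (h.intervalIntegrable a b).absolutelyContinuousOnInterval_intervalIntegral
    (c := a) left_mem_uIcc
  have hconst : AbsolutelyContinuousOnInterval (fun _ : ℝ => w a) a b :=
    (LipschitzWith.const (w a)).lipschitzOnWith.absolutelyContinuousOnInterval
  rw [h.eq_add a]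
  exact hconst.add hprimitive

lemma ae_hasDerivAt (h : IsLebesguePrimitive w g) : ∀ᵐ x, HasDerivAt w (g x) x := by
  filter_upwards [LocallyIntegrable.ae_hasDerivAt_integral h.locallyIntegrable] with x hx
  rw [h.eq_add 0]
  exact (hx 0).const_add _

lemma sub_eq_integral_comp (h : IsLebesguePrimitive w g) {G H : ℝ → ℝ}
    (hG : ∀ s, HasDerivAt G (H s) s) (hH : Continuous H) (a b : ℝ) :
    G (w b) - G (w a) = ∫ t in a..b, H (w t) * g t := by
  obtain ⟨C, hC⟩ := (h.absolutelyContinuousOnInterval a b).exists_bound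
  have hGsmooth : ContDiff ℝ 1 G := contDiff_one_iff_deriv.2
    ⟨fun s => (hG s).differentiableAt, by rwa [show deriv G = H from funext fun s => (hG s).deriv]⟩
  obtain ⟨K, hK⟩ := (hGsmooth.contDiffOn (s := Icc (-C) C)).exists_lipschitzOnWith (by decide)
    (convex_Icc _ _) isCompact_Icc
  have hac := absolutelyContinuousOnInterval_comp hK (h.absolutelyContinuousOnInterval a b)
    fun x hx => abs_le.1 (hC x hx)
  rw [← hac.integral_deriv_eq_sub]
  refine intervalIntegral.integral_congr_ae ?_
  filter_upwards [h.ae_hasDerivAt] with x hx _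
  exact ((hG (w x)).comp x hx).deriv

lemma integral_mul_deriv (h : IsLebesguePrimitive w g) {φ : ℝ → ℝ} (hφ : ContDiff ℝ 1 φ)
    (hc : HasCompactSupport φ) : ∫ x, w x * deriv φ x = -∫ x, g x * φ x := by
  obtain ⟨R, hR⟩ := hc.isCompact.isBounded.subset_ball (0 : ℝ)
  rw [Real.ball_eq_Ioo, zero_sub, zero_add] at hR
  have hφ_out : ∀ x ∉ Ioo (-R) R, φ x = 0 := fun x hx =>
    image_eq_zero_of_notMem_tsupport fun hx' => hx (hR hx')
  have hφ_supp : Function.support φ ⊆ Ioc (-R) R :=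
    (subset_tsupport φ).trans (hR.trans Ioo_subset_Ioc_self)
  have hφ'_supp : Function.support (deriv φ) ⊆ Ioc (-R) R :=
    (support_deriv_subset (f := φ)).trans (hR.trans Ioo_subset_Ioc_self)
  rw [← intervalIntegral.integral_eq_integral_of_support_subset
      ((Function.support_mul_subset_right w _).trans hφ'_supp),
    ← intervalIntegral.integral_eq_integral_of_support_subset
      ((Function.support_mul_subset_right g _).trans hφ_supp),
    (h.absolutelyContinuousOnInterval (-R) R).integral_mul_deriv_eq_deriv_mul
      hφ.contDiffOn.absolutelyContinuousOnInterval,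
    hφ_out R (by simp), hφ_out (-R) (by simp), mul_zero, mul_zero, sub_zero, zero_sub]
  congr 1
  refine intervalIntegral.integral_congr_ae ?_
  filter_upwards [h.ae_hasDerivAt] with x hx _
  rw [hx.deriv]

end IsLebesguePrimitive

lemma exists_hasCompactSupport_deriv_eq {ψ : ℝ → ℝ} (hψ : ContDiff ℝ (⊤ : ℕ∞) ψ)
    (hc : HasCompactSupport ψ) (hzero : ∫ x, ψ x = 0) :
    ∃ Ψ : ℝ → ℝ, ContDiff ℝ (⊤ : ℕ∞) Ψ ∧ HasCompactSupport Ψ ∧ deriv Ψ = ψ := by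
  obtain ⟨R, hR⟩ := hc.isCompact.isBounded.subset_ball (0 : ℝ)
  rw [Real.ball_eq_Ioo, zero_sub, zero_add] at hR
  have hsupp : Function.support ψ ⊆ Ioc (-R) R :=
    (subset_tsupport ψ).trans (hR.trans Ioo_subset_Ioc_self)
  have hΨ : ∀ x, HasDerivAt (fun x => ∫ t in (-R)..x, ψ t) (ψ x) x := fun x =>
    (hψ.continuous.integral_hasStrictDerivAt (-R) x).hasDerivAt
  have hderiv : deriv (fun x => ∫ t in (-R)..x, ψ t) = ψ := funext fun x => (hΨ x).deriv
  refine ⟨fun x => ∫ t in (-R)..x, ψ t, ?_, ?_, hderiv⟩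
  · rw [contDiff_infty_iff_deriv, hderiv]
    exact ⟨fun x => (hΨ x).differentiableAt, hψ⟩
  · refine HasCompactSupport.intro (isCompact_Icc (a := -R) (b := R)) fun x hx => ?_
    rcases not_and_or.1 hx with hx | hx <;> rw [not_le] at hx
    · refine intervalIntegral.integral_zero_ae (.of_forall fun t ht => ?_)
      rw [uIoc_of_ge hx.le] at ht
      exact Function.notMem_support.1 fun ht' => (hsupp ht').1.not_ge ht.2
    · rw [intervalIntegral.integral_eq_integral_of_support_subset
        (hsupp.trans (Ioc_subset_Ioc_right hx.le)), hzero]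

/- Subtract from `φ` the multiple `(∫ φ) φ₀` of a bump function `φ₀` of integral `1`: what remains
is the derivative of a test function. -/
lemma exists_forall_integral_mul_eq (hw : LocallyIntegrable w volume)
    (h : ∀ φ : ℝ → ℝ, ContDiff ℝ (⊤ : ℕ∞) φ → HasCompactSupport φ → ∫ x, w x * deriv φ x = 0) :
    ∃ c : ℝ, ∀ φ : ℝ → ℝ, ContDiff ℝ (⊤ : ℕ∞) φ → HasCompactSupport φ →
      ∫ x, w x * φ x = c * ∫ x, φ x := by
  let bump : ContDiffBump (0 : ℝ) := ⟨1, 2, one_pos, one_lt_two⟩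
  obtain ⟨φ₀, hφ₀, hφ₀c, hφ₀_one⟩ : ∃ φ₀ : ℝ → ℝ,
      ContDiff ℝ (⊤ : ℕ∞) φ₀ ∧ HasCompactSupport φ₀ ∧ ∫ x, φ₀ x = 1 :=
    ⟨bump.normed volume, bump.contDiff_normed, bump.hasCompactSupport_normed,
      bump.integral_normed⟩
  refine ⟨∫ x, w x * φ₀ x, fun φ hφ hφc => ?_⟩
  obtain ⟨Ψ, hΨ, hΨc, hΨ'⟩ := exists_hasCompactSupport_deriv_eq
    (ψ := fun x => φ x - (∫ y, φ y) * φ₀ x) (hφ.sub (contDiff_const.mul hφ₀))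
    (hφc.sub hφ₀c.mul_left) (by
      rw [integral_sub (hφ.continuous.integrable_of_hasCompactSupport hφc)
        ((hφ₀.continuous.integrable_of_hasCompactSupport hφ₀c).const_mul _),
        integral_const_mul, hφ₀_one, mul_one, sub_self])
  have hwφ : Integrable fun x => w x * φ x :=
    hw.integrable_smul_right_of_hasCompactSupport hφ.continuous hφc
  have hwφ₀ : Integrable fun x => w x * φ₀ x :=
    hw.integrable_smul_right_of_hasCompactSupport hφ₀.continuous hφ₀c
  have hortho := h Ψ hΨ hΨc
  simp only [hΨ', mul_sub, mul_left_comm (w _)] at hortho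
  rw [integral_sub hwφ (hwφ₀.const_mul _), integral_const_mul] at hortho
  linear_combination hortho

lemma exists_ae_eq_const_of_integral_mul_deriv_eq_zero (hw : LocallyIntegrable w volume)
    (h : ∀ φ : ℝ → ℝ, ContDiff ℝ (⊤ : ℕ∞) φ → HasCompactSupport φ → ∫ x, w x * deriv φ x = 0) :
    ∃ c : ℝ, ∀ᵐ x, w x = c := by
  obtain ⟨c, hc⟩ := exists_forall_integral_mul_eq hw h
  have hzero : ∀ᵐ x, w x - c = 0 := by
    refine ae_eq_zero_of_integral_contDiff_smul_eq_zero (f := fun x => w x - c)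
      (hw.sub continuous_const.locallyIntegrable) fun φ hφ hφc => ?_
    have hwφ : Integrable fun x => w x * φ x :=
      hw.integrable_smul_right_of_hasCompactSupport hφ.continuous hφc
    have hcφ := (hφ.continuous.integrable_of_hasCompactSupport (μ := volume) hφc).const_mul c
    simp only [smul_eq_mul, mul_comm (φ _), sub_mul]
    rw [integral_sub hwφ hcφ, integral_const_mul, hc φ hφ hφc, sub_self]
  exact ⟨c, hzero.mono fun x hx => sub_eq_zero.1 hx⟩

lemma HasWeakDeriv.exists_primitive {v g : ℝ → ℝ} (h : HasWeakDeriv v g) :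
    ∃ w : ℝ → ℝ, IsLebesguePrimitive w g ∧ v =ᵐ[volume] w := by
  obtain ⟨hv, hg, hvg⟩ := h
  have hW := isLebesguePrimitive_integral hg 0
  set W : ℝ → ℝ := fun x => 0 + ∫ t in (0 : ℝ)..x, g t with hW_def
  have hWl := hW.continuous.locallyIntegrable (μ := volume)
  obtain ⟨c, hc⟩ := exists_ae_eq_const_of_integral_mul_deriv_eq_zero (hv.sub hWl)
    fun φ hφ hφc => by
      have hφ' : Continuous (deriv φ) := hφ.continuous_deriv (by simp)
      have hvφ : Integrable fun x => v x * deriv φ x :=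
        hv.integrable_smul_right_of_hasCompactSupport hφ' hφc.deriv
      have hWφ : Integrable fun x => W x * deriv φ x :=
        hWl.integrable_smul_right_of_hasCompactSupport hφ' hφc.deriv
      simp only [Pi.sub_apply, sub_mul]
      rw [integral_sub hvφ hWφ, hvg φ hφ hφc,
        hW.integral_mul_deriv (hφ.of_le (by exact_mod_cast le_top)) hφc, sub_self]
  refine ⟨_, isLebesguePrimitive_integral hg c, hc.mono fun x hx => ?_⟩
  simp only [hW_def, Pi.sub_apply, zero_add] at hx
  linarith

end WeakDerivatives

section HeightSweep

variable {w g H : ℝ → ℝ} {s : ℝ}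

lemma exists_mem_abs_lt {α : Type*} [MeasurableSpace α] {μ : Measure α} {f : α → ℝ} {S : Set α}
    {δ : ℝ} (hs : 0 < s) (hδ : 0 < δ) (hfi : Integrable (fun x => |f x| ^ s) μ) (hS : μ S = ⊤) :
    ∃ x ∈ S, |f x| < δ := by
  by_contra! hle
  have hsub : S ⊆ {x | δ ^ s ≤ ‖|f x| ^ s‖} := fun x hx =>
    (Real.rpow_le_rpow hδ.le (hle x hx) hs.le).trans (le_abs_self _)
  exact ((measure_mono hsub).trans_lt
    (hfi.measure_norm_ge_lt_top (Real.rpow_pos_of_pos hδ s))).ne hS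

lemma abs_integral_of_even (hH0 : ∀ t, 0 ≤ H t) (heven : Function.Even H) (y : ℝ) :
    |∫ t in (0 : ℝ)..y, H t| = ∫ t in (0 : ℝ)..|y|, H t := by
  rcases le_total 0 y with hy | hy
  · rw [abs_of_nonneg hy, abs_of_nonneg (intervalIntegral.integral_nonneg hy fun t _ => hH0 t)]
  · have hreflect : ∫ t in (0 : ℝ)..y, H t = -∫ t in (0 : ℝ)..-y, H t := by
      have hneg := intervalIntegral.integral_comp_neg (f := H) (a := 0) (b := y)
      simp only [heven _, neg_zero] at hneg
      rw [hneg, intervalIntegral.integral_symm]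
    rw [abs_of_nonpos hy, hreflect, abs_neg,
      abs_of_nonneg (intervalIntegral.integral_nonneg (neg_nonneg.2 hy) fun t _ => hH0 t)]

namespace IsLebesguePrimitive

lemma abs_integral_sub_le (h : IsLebesguePrimitive w g) (hH : Continuous H) (hH0 : ∀ t, 0 ≤ H t)
    {a b : ℝ} (hab : a ≤ b) :
    |(∫ t in (0 : ℝ)..w b, H t) - ∫ t in (0 : ℝ)..w a, H t| ≤ ∫ x in a..b, |g x| * H (w x) := by
  rw [h.sub_eq_integral_comp (fun y => hH.integral_hasStrictDerivAt 0 y |>.hasDerivAt) hH]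
  refine (intervalIntegral.abs_integral_le_integral_abs hab).trans_eq ?_
  simp only [abs_mul, abs_of_nonneg (hH0 _), mul_comm]

lemma two_mul_integral_le_add (h : IsLebesguePrimitive w g) (hH : Continuous H)
    (hH0 : ∀ t, 0 ≤ H t) (heven : Function.Even H)
    (hgH : Integrable fun x => |g x| * H (w x)) {a x b : ℝ} (hax : a ≤ x) (hxb : x ≤ b) :
    2 * ∫ t in (0 : ℝ)..|w x|, H t ≤ (∫ x, |g x| * H (w x)) +
      ((∫ t in (0 : ℝ)..|w a|, H t) + ∫ t in (0 : ℝ)..|w b|, H t) := by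
  have hleft := (abs_sub_abs_le_abs_sub _ _).trans (h.abs_integral_sub_le hH hH0 hax)
  have hright := (abs_sub_abs_le_abs_sub _ _).trans
    ((abs_sub_comm _ _).trans_le (h.abs_integral_sub_le hH hH0 hxb))
  have hadd := intervalIntegral.integral_add_adjacent_intervals
    (hgH.intervalIntegrable (a := a) (b := x)) (hgH.intervalIntegrable (a := x) (b := b))
  have hle : ∫ x in a..b, |g x| * H (w x) ≤ ∫ x, |g x| * H (w x) := by
    rw [intervalIntegral.integral_of_le (hax.trans hxb)]
    exact setIntegral_le_integral hgH
      (Eventually.of_forall fun x => mul_nonneg (abs_nonneg _) (hH0 _))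
  rw [abs_integral_of_even hH0 heven, abs_integral_of_even hH0 heven] at hleft hright
  linarith

-- As `w` is small somewhere on both sides of `x`, it sweeps the heights `[0, |w x|]` twice.
lemma two_mul_integral_le (h : IsLebesguePrimitive w g) (hs : 0 < s)
    (hw : Integrable fun x => |w x| ^ s) (hH : Continuous H) (hH0 : ∀ t, 0 ≤ H t)
    (heven : Function.Even H) (hgH : Integrable fun x => |g x| * H (w x)) (x : ℝ) :
    2 * ∫ t in (0 : ℝ)..|w x|, H t ≤ ∫ x, |g x| * H (w x) := by
  refine le_of_forall_pos_le_add fun ε hε => ?_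
  have hcont : Tendsto (fun y => ∫ t in (0 : ℝ)..|y|, H t) (𝓝 0) (𝓝 0) := by
    have hprimitive := (intervalIntegral.continuous_primitive
      (fun a b => hH.intervalIntegrable (μ := volume) a b) 0).comp continuous_abs
    simpa only [Function.comp_def, abs_zero, intervalIntegral.integral_same]
      using hprimitive.tendsto 0
  obtain ⟨δ, hδ, hsmall⟩ := Metric.eventually_nhds_iff.1
    (hcont.eventually_lt_const (half_pos hε))
  simp only [Real.dist_0_eq_abs] at hsmall
  obtain ⟨a, hax, ha⟩ := exists_mem_abs_lt hs hδ hw (S := Iio x) Real.volume_Iio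
  obtain ⟨b, hxb, hb⟩ := exists_mem_abs_lt hs hδ hw (S := Ioi x) Real.volume_Ioi
  have hsweep := h.two_mul_integral_le_add hH hH0 heven hgH (le_of_lt hax) (le_of_lt hxb)
  linarith [hsmall ha, hsmall hb]

lemma two_mul_integral_le_rpow (h : IsLebesguePrimitive w g) {p : ℝ} (hp : 1 < p) (hs : 0 < s)
    (hgp : Integrable fun x => |g x| ^ p) (hw : Integrable fun x => |w x| ^ s)
    (hH : Continuous H) (hH0 : ∀ t, 0 ≤ H t) (heven : Function.Even H)
    (hHw : Integrable fun x => H (w x) ^ (p / (p - 1))) (x : ℝ) :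
    2 * ∫ t in (0 : ℝ)..|w x|, H t ≤
      (∫ x, |g x| ^ p) ^ (1 / p) * (∫ x, H (w x) ^ (p / (p - 1))) ^ ((p - 1) / p) := by
  have hp0 : 0 < p := one_pos.trans hp
  have hconj : p.HolderConjugate (p / (p - 1)) := Real.HolderConjugate.conjExponent hp
  have hgLp : MemLp (fun x => |g x|) (ENNReal.ofReal p) :=
    ((memLp_ofReal_iff h.locallyIntegrable.aestronglyMeasurable hp0).2 hgp).abs
  have hHLp : MemLp (fun x => H (w x)) (ENNReal.ofReal (p / (p - 1))) :=
    (memLp_ofReal_iff (hH.comp h.continuous).aestronglyMeasurable (conjExponent_pos hp)).2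
      (by simpa only [Function.comp_apply, abs_of_nonneg (hH0 _)] using hHw)
  have hgH : Integrable fun x => |g x| * H (w x) :=
    have := hconj.ennrealOfReal
    hgLp.integrable_mul hHLp
  have hholder := integral_mul_le_Lp_mul_Lq_of_nonneg hconj (μ := volume)
    (Eventually.of_forall fun x => abs_nonneg (g x)) (Eventually.of_forall fun x => hH0 (w x))
    hgLp hHLp
  rw [one_div_div] at hholder
  exact (h.two_mul_integral_le hs hw hH hH0 heven hgH x).trans hholder

lemma exists_abs_le (h : IsLebesguePrimitive w g) {p : ℝ} (hp : 1 < p) (hs : 0 < s)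
    (hgp : Integrable fun x => |g x| ^ p) (hw : Integrable fun x => |w x| ^ s) :
    ∃ C, ∀ x, |w x| ≤ C := by
  have hp1 : 0 < p - 1 := sub_pos.2 hp
  set e := s * ((p - 1) / p) with he
  have he0 : 0 < e := by positivity
  have hpow : ∀ x, (|w x| ^ e) ^ (p / (p - 1)) = |w x| ^ s := fun x => by
    rw [← Real.rpow_mul (abs_nonneg _), he]
    field_simp
  have hintegral : ∀ y : ℝ, 0 ≤ y → ∫ t in (0 : ℝ)..y, |t| ^ e = y ^ (e + 1) / (e + 1) := by
    intro y hy
    rw [intervalIntegral.integral_congr (g := fun t => t ^ e),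
      integral_rpow (Or.inl (by linarith)), Real.zero_rpow (by positivity), sub_zero]
    intro t ht
    rw [uIcc_of_le hy] at ht
    simp only [abs_of_nonneg ht.1]
  refine ⟨((e + 1) / 2 * ((∫ x, |g x| ^ p) ^ (1 / p) *
    (∫ x, |w x| ^ s) ^ ((p - 1) / p))) ^ (e + 1)⁻¹, fun x => ?_⟩
  have hsweep := h.two_mul_integral_le_rpow hp hs hgp hw
    ((Real.continuous_rpow_const he0.le).comp continuous_abs)
    (fun t => Real.rpow_nonneg (abs_nonneg t) e)
    (fun t => by simp only [Function.comp_apply, abs_neg])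
    (by simpa only [Function.comp_apply, hpow] using hw) x
  simp only [Function.comp_apply, hpow, hintegral _ (abs_nonneg (w x))] at hsweep
  have hP : 0 ≤ ∫ x, |g x| ^ p := integral_nonneg fun x => by positivity
  have hB : 0 ≤ ∫ x, |w x| ^ s := integral_nonneg fun x => by positivity
  rw [Real.le_rpow_inv_iff_of_pos (abs_nonneg _) (by positivity) (by positivity),
    div_mul_eq_mul_div, le_div_iff₀' two_pos]
  rwa [mul_div_assoc', div_le_iff₀' (by positivity)] at hsweep

end IsLebesguePrimitive

end HeightSweep

section Interpolation

variable {p q m M : ℝ} {w g : ℝ → ℝ}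

lemma eta1_pos (hp : 1 < p) (hm : 0 < m + 1) : 0 < eta1 p m := by
  have := mul_pos (sub_pos.2 hp) hm
  unfold eta1
  linarith

lemma eta2_pos (hp : 1 < p) (hq : 0 < q + 1) : 0 < eta2 p q := by
  have := mul_pos (sub_pos.2 hp) hq
  unfold eta2
  linarith

lemma eta1_sub_eta2 : eta1 p m - eta2 p q = (p - 1) * (m - q) := by
  unfold eta1 eta2
  ring

/-- The integral `∫₀¹ (t^(q+1) - t^(m+1))^((p-1)/p) dt`, a Beta integral in disguise, through which
all the sharp constants are expressed. -/
noncomputable def profileIntegral (p q m : ℝ) : ℝ :=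
  ∫ t in (0 : ℝ)..1, (t ^ (q + 1) - t ^ (m + 1)) ^ ((p - 1) / p)

lemma profileIntegral_pos (hp : 1 < p) (hq : 0 < q + 1) (hm : q < m) :
    0 < profileIntegral p q m := by
  have hα : 0 < (p - 1) / p := div_pos (by linarith) (by linarith)
  refine intervalIntegral.intervalIntegral_pos_of_pos_on ?_ (fun t ht => ?_) zero_lt_one
  · exact Continuous.intervalIntegrable ((Real.continuous_rpow_const hα.le).comp
      ((Real.continuous_rpow_const hq.le).sub (Real.continuous_rpow_const (by linarith)))) _ _
  · exact Real.rpow_pos_of_pos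
      (sub_pos.2 (Real.rpow_lt_rpow_of_exponent_gt ht.1 ht.2 (by linarith))) _

lemma integral_rpow_sub_rpow (hp : 1 < p) (hq : 0 < q + 1) (hm : q < m) (hM : 0 < M) :
    ∫ s in (0 : ℝ)..M, (M ^ (m - q) * s ^ (q + 1) - s ^ (m + 1)) ^ ((p - 1) / p) =
      M ^ (eta1 p m / p) * profileIntegral p q m := by
  have hscale := intervalIntegral.mul_integral_comp_mul_left (a := 0) (b := 1) (c := M)
    (f := fun s => (M ^ (m - q) * s ^ (q + 1) - s ^ (m + 1)) ^ ((p - 1) / p))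
  rw [mul_zero, mul_one] at hscale
  have hη : eta1 p m / p = 1 + (m + 1) * ((p - 1) / p) := by
    unfold eta1
    field_simp
    ring
  rw [← hscale, hη, Real.rpow_add hM, Real.rpow_one, mul_assoc, profileIntegral]
  congr 1
  rw [← intervalIntegral.integral_const_mul]
  refine intervalIntegral.integral_congr fun t ht => ?_
  rw [uIcc_of_le zero_le_one] at ht
  have hhomogeneous : M ^ (m - q) * (M * t) ^ (q + 1) - (M * t) ^ (m + 1) =
      M ^ (m + 1) * (t ^ (q + 1) - t ^ (m + 1)) := by
    rw [Real.mul_rpow hM.le ht.1, Real.mul_rpow hM.le ht.1, ← mul_assoc, ← Real.rpow_add hM]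
    ring_nf
  have hnonneg : 0 ≤ t ^ (q + 1) - t ^ (m + 1) := by
    simpa only [Real.one_rpow, one_mul, sub_nonneg] using rpow_add_one_le hq hm ht.1 ht.2
  rw [hhomogeneous, Real.mul_rpow (by positivity) hnonneg, ← Real.rpow_mul hM.le]

/-- The weight of the sharp inequality for functions of height `M`. A rescaled ground state `w` of
that height has `|w'| ^ (p - 1)` proportional to it, so that Hölder's inequality is then an
equality. The truncation `max 0` only matters for `|s| > M`. -/
noncomputable def heightWeight (p q m M s : ℝ) : ℝ :=
  (max 0 (M ^ (m - q) * |s| ^ (q + 1) - |s| ^ (m + 1))) ^ ((p - 1) / p)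

lemma continuous_heightWeight (hp : 1 < p) (hq : 0 < q + 1) (hm : q < m) :
    Continuous (heightWeight p q m M) := by
  have hα : 0 < (p - 1) / p := div_pos (by linarith) (by linarith)
  have habs_rpow : ∀ {a : ℝ}, 0 ≤ a → Continuous fun s : ℝ => |s| ^ a := fun ha =>
    (Real.continuous_rpow_const ha).comp continuous_abs
  exact (Real.continuous_rpow_const hα.le).comp (continuous_const.max
    (((habs_rpow hq.le).const_mul _).sub (habs_rpow (by linarith))))

lemma heightWeight_nonneg (s : ℝ) : 0 ≤ heightWeight p q m M s :=
  Real.rpow_nonneg (le_max_left _ _) _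

lemma even_heightWeight : Function.Even (heightWeight p q m M) := fun s => by
  simp only [heightWeight, abs_neg]

lemma heightWeight_eq (hq : 0 < q + 1) (hm : q < m) {s : ℝ} (hs : |s| ≤ M) :
    heightWeight p q m M s = (M ^ (m - q) * |s| ^ (q + 1) - |s| ^ (m + 1)) ^ ((p - 1) / p) := by
  rw [heightWeight, max_eq_right (sub_nonneg.2 (rpow_add_one_le hq hm (abs_nonneg s) hs))]

lemma heightWeight_rpow (hp : 1 < p) (hq : 0 < q + 1) (hm : q < m) {s : ℝ} (hs : |s| ≤ M) :
    heightWeight p q m M s ^ (p / (p - 1)) = M ^ (m - q) * |s| ^ (q + 1) - |s| ^ (m + 1) := by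
  have hp1 : 0 < p - 1 := sub_pos.2 hp
  rw [heightWeight_eq hq hm hs,
    ← Real.rpow_mul (sub_nonneg.2 (rpow_add_one_le hq hm (abs_nonneg s) hs)),
    div_mul_div_cancel₀ (by linarith), div_self hp1.ne', Real.rpow_one]

lemma integral_heightWeight (hp : 1 < p) (hq : 0 < q + 1) (hm : q < m) (hM : 0 < M) :
    ∫ s in (0 : ℝ)..M, heightWeight p q m M s = M ^ (eta1 p m / p) * profileIntegral p q m := by
  rw [← integral_rpow_sub_rpow hp hq hm hM]
  refine intervalIntegral.integral_congr fun s hs => ?_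
  rw [uIcc_of_le hM.le] at hs
  simp only [heightWeight_eq hq hm (abs_le.2 ⟨by linarith [hs.1], hs.2⟩), abs_of_nonneg hs.1]

lemma IsLebesguePrimitive.integrable_abs_rpow_add_one (h : IsLebesguePrimitive w g)
    (hq : 0 < q + 1) (hm : q < m) (hw : Integrable fun x => |w x| ^ (q + 1))
    (hM : ∀ x, |w x| ≤ M) : Integrable fun x => |w x| ^ (m + 1) :=
  integrable_rpow_add_one h.continuous.abs.aestronglyMeasurable hq hm
    (Eventually.of_forall fun _ => abs_nonneg _) (Eventually.of_forall hM) hw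

lemma IsLebesguePrimitive.sup_interpolation (h : IsLebesguePrimitive w g) (hp : 1 < p)
    (hq : 0 < q + 1) (hm : q < m) (hgp : Integrable fun x => |g x| ^ p)
    (hw : Integrable fun x => |w x| ^ (q + 1)) (hM : 0 < M)
    (hlub : IsLUB (range fun x => |w x|) M) :
    2 * profileIntegral p q m * M ^ (eta1 p m / p) ≤ (∫ x, |g x| ^ p) ^ (1 / p) *
      (M ^ (m - q) * (∫ x, |w x| ^ (q + 1)) - ∫ x, |w x| ^ (m + 1)) ^ ((p - 1) / p) := by
  have hwM : ∀ x, |w x| ≤ M := fun x => hlub.1 ⟨x, rfl⟩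
  have hwm := h.integrable_abs_rpow_add_one hq hm hw hwM
  have hcont := continuous_heightWeight (M := M) hp hq hm
  have hsweep := h.two_mul_integral_le_rpow hp hq hgp hw hcont heightWeight_nonneg
    even_heightWeight (by
      simp only [heightWeight_rpow hp hq hm (hwM _)]
      exact (hw.const_mul _).sub hwm)
  simp only [heightWeight_rpow hp hq hm (hwM _)] at hsweep
  rw [integral_sub (hw.const_mul _) hwm, integral_const_mul] at hsweep
  have hclosed := isClosed_le
    ((intervalIntegral.continuous_primitive
      (fun a b => hcont.intervalIntegrable (μ := volume) a b) 0).const_mul 2)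
    (continuous_const (y := (∫ x, |g x| ^ p) ^ (1 / p) *
      (M ^ (m - q) * (∫ x, |w x| ^ (q + 1)) - ∫ x, |w x| ^ (m + 1)) ^ ((p - 1) / p)))
  have hsup := closure_minimal (range_subset_iff.2 hsweep) hclosed
    (hlub.mem_closure (range_nonempty _))
  rw [mem_ofPred_eq, integral_heightWeight hp hq hm hM] at hsup
  linarith

end Interpolation

section Optimization

variable {p q m M A B P : ℝ}

-- Young's inequality for `α x^a = (x^a t)(α / t)`, with `t` such that `(x^a t)^(c/a)` is `x^c` up
-- to the factor that reproduces `β x^c`.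
lemma rpow_sub_rpow_le {a c α β x : ℝ} (ha : 0 < a) (hac : a < c) (hα : 0 ≤ α) (hβ : 0 < β)
    (hx : 0 < x) : α * x ^ a - β * x ^ c ≤
      (c - a) / c * (a / c) ^ (a / (c - a)) * α ^ (c / (c - a)) * β ^ (-(a / (c - a))) := by
  have hc : 0 < c := ha.trans hac
  have hca : 0 < c - a := sub_pos.2 hac
  have hconj : (c / a).HolderConjugate (c / (c - a)) := by
    rw [Real.holderConjugate_iff]
    refine ⟨(one_lt_div ha).2 hac, ?_⟩
    field_simp
    ring
  set t := (β * (c / a)) ^ (a / c) with ht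
  have ht0 : 0 < t := by positivity
  have hyoung := Real.young_inequality_of_nonneg (a := x ^ a * t) (b := α / t) (by positivity)
    (by positivity) hconj
  have hproduct : x ^ a * t * (α / t) = α * x ^ a := by field_simp
  have hfirst : (x ^ a * t) ^ (c / a) / (c / a) = β * x ^ c := by
    rw [Real.mul_rpow (by positivity) ht0.le, ← Real.rpow_mul hx.le, ht,
      ← Real.rpow_mul (by positivity), mul_div_cancel₀ _ ha.ne',
      div_mul_div_cancel₀ hc.ne', div_self ha.ne', Real.rpow_one]
    field_simp
  have hsecond : (α / t) ^ (c / (c - a)) / (c / (c - a)) =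
      (c - a) / c * (a / c) ^ (a / (c - a)) * α ^ (c / (c - a)) * β ^ (-(a / (c - a))) := by
    rw [Real.div_rpow hα ht0.le, ht, ← Real.rpow_mul (by positivity),
      div_mul_div_cancel₀ hc.ne', Real.mul_rpow hβ.le (by positivity), Real.rpow_neg hβ.le,
      ← inv_div c a, Real.inv_rpow (by positivity)]
    field_simp
  rw [hproduct, hfirst, hsecond] at hyoung
  linarith

lemma rpow_mul_rpow_le_of_le {N X a : ℝ} (hp : 1 < p) (hN : 0 ≤ N) (hM : 0 ≤ M) (hP : 0 ≤ P)
    (hX : 0 ≤ X) (hle : N * M ^ (a / p) ≤ P ^ (1 / p) * X ^ ((p - 1) / p)) :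
    N ^ (p / (p - 1)) * M ^ (a / (p - 1)) ≤ P ^ (1 / (p - 1)) * X := by
  have hp1 : 0 < p - 1 := sub_pos.2 hp
  have hp0 : p ≠ 0 := by linarith
  have hpow := Real.rpow_le_rpow (by positivity) hle (conjExponent_pos hp).le
  rwa [Real.mul_rpow hN (by positivity), Real.mul_rpow (by positivity) (by positivity),
    ← Real.rpow_mul hM, ← Real.rpow_mul hP, ← Real.rpow_mul hX, div_mul_div_cancel₀ hp0,
    div_mul_div_cancel₀ hp0, div_mul_div_cancel₀ hp0, div_self hp1.ne', Real.rpow_one] at hpow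

/-- The best constant in the Gagliardo–Nirenberg inequality for integrals,
`∫ |w| ^ (m + 1) ≤ K * (∫ |w| ^ (q + 1)) ^ (η₁ / η₂) * (∫ |w'| ^ p) ^ ((m - q) / η₂)`. -/
noncomputable def powConst (p q m : ℝ) : ℝ :=
  eta2 p q / eta1 p m * ((p - 1) * (m - q) / eta1 p m) ^ ((p - 1) * (m - q) / eta2 p q) *
    (2 * profileIntegral p q m) ^ (-(p * (m - q) / eta2 p q))

lemma powConst_pos (hp : 1 < p) (hq : 0 < q + 1) (hm : q < m) : 0 < powConst p q m := by
  have hI := profileIntegral_pos hp hq hm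
  have hη1 := eta1_pos hp (show 0 < m + 1 by linarith)
  have hη2 := eta2_pos hp hq
  have := sub_pos.2 hp
  have := sub_pos.2 hm
  unfold powConst
  positivity

lemma pos_of_sup_interpolation (hp : 1 < p) (hq : 0 < q + 1) (hm : q < m) (hM : 0 < M)
    (hP : 0 ≤ P) {X : ℝ}
    (hmain : 2 * profileIntegral p q m * M ^ (eta1 p m / p) ≤ P ^ (1 / p) * X) : 0 < P := by
  refine hP.lt_of_ne' ?_
  rintro rfl
  have hI := profileIntegral_pos hp hq hm
  rw [Real.zero_rpow (one_div_pos.2 (one_pos.trans hp)).ne', zero_mul] at hmain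
  exact hmain.not_gt (by positivity)

lemma le_powConst_of_sup_interpolation (hp : 1 < p) (hq : 0 < q + 1) (hm : q < m) (hM : 0 < M)
    (hB : 0 ≤ B) (hP : 0 ≤ P) (hA : A ≤ M ^ (m - q) * B)
    (hmain : 2 * profileIntegral p q m * M ^ (eta1 p m / p) ≤
      P ^ (1 / p) * (M ^ (m - q) * B - A) ^ ((p - 1) / p)) :
    A ≤ powConst p q m * B ^ (eta1 p m / eta2 p q) * P ^ ((m - q) / eta2 p q) := by
  have hp1 : 0 < p - 1 := sub_pos.2 hp
  have hI := profileIntegral_pos hp hq hm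
  have hη2 := eta2_pos hp hq
  have hmq : 0 < m - q := sub_pos.2 hm
  have hP0 := pos_of_sup_interpolation hp hq hm hM hP hmain
  set N := 2 * profileIntegral p q m with hN
  have hN0 : 0 < N := by positivity
  set β := N ^ (p / (p - 1)) / P ^ (1 / (p - 1)) with hβ
  have hAle : A ≤ B * M ^ (m - q) - β * M ^ (eta1 p m / (p - 1)) := by
    have hpow := rpow_mul_rpow_le_of_le hp hN0.le hM.le hP (sub_nonneg.2 hA) hmain
    rw [← div_le_iff₀' (by positivity), ← div_mul_eq_mul_div, ← hβ] at hpow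
    linarith
  have hca : eta1 p m / (p - 1) - (m - q) = eta2 p q / (p - 1) := by
    rw [eq_div_iff hp1.ne', sub_mul, div_mul_cancel₀ _ hp1.ne']
    linarith [eta1_sub_eta2 (p := p) (q := q) (m := m)]
  have hmax := rpow_sub_rpow_le (a := m - q) (c := eta1 p m / (p - 1)) (β := β) hmq
    (by rw [← sub_pos, hca]; positivity) hB (by positivity) hM
  rw [hca] at hmax
  refine (hAle.trans hmax).trans_eq ?_
  have hβpow : β ^ (-((m - q) / (eta2 p q / (p - 1)))) =
      N ^ (-(p * (m - q) / eta2 p q)) * P ^ ((m - q) / eta2 p q) := by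
    rw [hβ, Real.div_rpow (by positivity) (by positivity), ← Real.rpow_mul hN0.le,
      ← Real.rpow_mul hP, div_eq_mul_inv, ← Real.rpow_neg hP]
    congr 2 <;> field_simp
  rw [hβpow, powConst, ← hN, div_div_div_cancel_right₀ hp1.ne', div_div_div_cancel_right₀ hp1.ne',
    div_div_eq_mul_div, div_div_eq_mul_div, mul_comm (m - q)]
  ring

end Optimization

lemma IsLebesguePrimitive.integral_rpow_add_one_le {p q m : ℝ} {w g : ℝ → ℝ}
    (h : IsLebesguePrimitive w g) (hp : 1 < p) (hq : 0 < q + 1) (hm : q < m)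
    (hgp : Integrable fun x => |g x| ^ p) (hw : Integrable fun x => |w x| ^ (q + 1)) :
    ∫ x, |w x| ^ (m + 1) ≤ powConst p q m *
      (∫ x, |w x| ^ (q + 1)) ^ (eta1 p m / eta2 p q) * (∫ x, |g x| ^ p) ^ ((m - q) / eta2 p q) := by
  have hB : 0 ≤ ∫ x, |w x| ^ (q + 1) := integral_nonneg fun x => by positivity
  have hP : 0 ≤ ∫ x, |g x| ^ p := integral_nonneg fun x => by positivity
  obtain ⟨C, hC⟩ := h.exists_abs_le hp hq hgp hw
  have hlub := isLUB_csSup (range_nonempty fun x => |w x|) ⟨C, forall_mem_range.2 hC⟩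
  set M := sSup (range fun x => |w x|)
  have hwM : ∀ x, |w x| ≤ M := fun x => hlub.1 ⟨x, rfl⟩
  rcases ((abs_nonneg (w 0)).trans (hwM 0)).eq_or_lt with hM | hM
  · have hw0 : ∀ x, |w x| = 0 := fun x => le_antisymm (hM ▸ hwM x) (abs_nonneg _)
    have := powConst_pos hp hq hm
    simp only [hw0, Real.zero_rpow (show m + 1 ≠ 0 by linarith), integral_zero]
    positivity
  · refine le_powConst_of_sup_interpolation hp hq hm hM hB hP ?_
      (h.sup_interpolation hp hq hm hgp hw hM hlub)
    rw [← integral_const_mul]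
    exact integral_mono (h.integrable_abs_rpow_add_one hq hm hw hwM) (hw.const_mul _)
      fun x => rpow_add_one_le hq hm (abs_nonneg _) (hwM x)

section Constants

variable {p q m M : ℝ}

lemma integral_comp_rpow_zero_one {c : ℝ} (hc : 0 < c) (f : ℝ → ℝ) :
    ∫ t in (0 : ℝ)..1, c * t ^ (c - 1) * f (t ^ c) = ∫ t in (0 : ℝ)..1, f t := by
  have hsubst := integral_comp_rpow_Ioi_of_pos (g := (Iic 1).indicator f) hc
  have hindicator : ∀ x ∈ Ioi (0 : ℝ), (c * x ^ (c - 1)) • (Iic 1).indicator f (x ^ c) =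
      (Iic 1).indicator (fun t => c * t ^ (c - 1) * f (t ^ c)) x := by
    intro x hx
    have hiff : x ^ c ∈ Iic 1 ↔ x ∈ Iic 1 := by
      simpa only [mem_Iic, Real.one_rpow] using Real.rpow_le_rpow_iff (le_of_lt hx) zero_le_one hc
    by_cases hx1 : x ∈ Iic 1
    · rw [indicator_of_mem hx1, indicator_of_mem (hiff.2 hx1), smul_eq_mul]
    · rw [indicator_of_notMem hx1, indicator_of_notMem (mt hiff.1 hx1), smul_zero]
  rwa [setIntegral_congr_fun measurableSet_Ioi hindicator, setIntegral_indicator measurableSet_Iic,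
    setIntegral_indicator measurableSet_Iic, Ioi_inter_Iic,
    ← intervalIntegral.integral_of_le zero_le_one,
    ← intervalIntegral.integral_of_le zero_le_one] at hsubst

lemma profileIntegral_eq (hp : 1 < p) (hm : q < m) :
    profileIntegral p q m =
      completeBeta (eta2 p q / (p * (m - q))) ((2 * p - 1) / p) / (m - q) := by
  have hp0 : p ≠ 0 := by linarith
  have hmq : 0 < m - q := sub_pos.2 hm
  rw [eq_div_iff hmq.ne', mul_comm, completeBeta, incBeta, ← integral_comp_rpow_zero_one hmq,
    profileIntegral, ← intervalIntegral.integral_const_mul]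
  refine intervalIntegral.integral_congr_ae (Eventually.of_forall fun t ht => ?_)
  rw [uIoc_of_le zero_le_one] at ht
  have ht0 : 0 < t := ht.1
  have hle : 0 ≤ 1 - t ^ (m - q) := sub_nonneg.2 (Real.rpow_le_one ht0.le ht.2 hmq.le)
  have hfactor : t ^ (q + 1) - t ^ (m + 1) = t ^ (q + 1) * (1 - t ^ (m - q)) := by
    rw [mul_sub, mul_one, ← Real.rpow_add ht0]
    ring_nf
  have hpower : t ^ ((q + 1) * ((p - 1) / p)) =
      t ^ (m - q - 1) * t ^ ((m - q) * (eta2 p q / (p * (m - q)) - 1)) := by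
    rw [← Real.rpow_add ht0, eta2]
    congr 1
    field_simp
    ring
  have hexponent : (2 * p - 1) / p - 1 = (p - 1) / p := by
    field_simp
    ring
  rw [hfactor, Real.mul_rpow (by positivity) hle, ← Real.rpow_mul ht0.le, hpower,
    ← Real.rpow_mul ht0.le, hexponent]
  ring

lemma sharpConst_eq (hp : 1 < p) (hm : q < m) :
    sharpConst p q m = ((2 ^ p * (p - 1) ^ (1 - p) * eta1 p m ^ (eta1 p m / (m - q))) /
      ((m - q) ^ (2 * p - 1) * eta2 p q ^ (eta2 p q / (m - q))) *
        (profileIntegral p q m * (m - q)) ^ p) ^ (-ell p q m) := by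
  rw [sharpConst, profileIntegral_eq hp hm, div_mul_cancel₀ _ (sub_pos.2 hm).ne']

lemma sharpConst_pos (hp : 1 < p) (hq : 0 < q + 1) (hm : q < m) : 0 < sharpConst p q m := by
  have := sub_pos.2 hp
  have := sub_pos.2 hm
  have := eta1_pos hp (show 0 < m + 1 by linarith)
  have := eta2_pos hp hq
  have := profileIntegral_pos hp hq hm
  rw [sharpConst_eq hp hm]
  positivity

lemma log_sharpConst (hp : 1 < p) (hq : 0 < q + 1) (hm : q < m) :
    Real.log (sharpConst p q m) = -ell p q m *
      (p * Real.log 2 + (1 - p) * Real.log (p - 1) + eta1 p m / (m - q) * Real.log (eta1 p m)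
        - (2 * p - 1) * Real.log (m - q) - eta2 p q / (m - q) * Real.log (eta2 p q)
        + p * (Real.log (profileIntegral p q m) + Real.log (m - q))) := by
  have hp1 : 0 < p - 1 := sub_pos.2 hp
  have hmq : 0 < m - q := sub_pos.2 hm
  have hη1 := eta1_pos hp (show 0 < m + 1 by linarith)
  have hη2 := eta2_pos hp hq
  have hI := profileIntegral_pos hp hq hm
  rw [sharpConst_eq hp hm, Real.log_rpow (by positivity),
    Real.log_mul (by positivity) (by positivity), Real.log_div (by positivity) (by positivity),
    Real.log_mul (by positivity) (by positivity), Real.log_mul (by positivity) (by positivity),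
    Real.log_mul (by positivity) (by positivity), Real.log_rpow two_pos, Real.log_rpow hp1,
    Real.log_rpow hη1, Real.log_rpow hmq, Real.log_rpow hη2, Real.log_rpow (by positivity),
    Real.log_mul hI.ne' hmq.ne']
  ring

lemma ell_eq : ell p q m = (m - q) / ((m + 1) * eta2 p q) := rfl

lemma powConst_eq (hp : 1 < p) (hq : 0 < q + 1) (hm : q < m) :
    powConst p q m = sharpConst p q m ^ (m + 1) := by
  have hp1 : 0 < p - 1 := sub_pos.2 hp
  have hmq : 0 < m - q := sub_pos.2 hm
  have hm1 : 0 < m + 1 := by linarith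
  have hη1 := eta1_pos hp hm1
  have hη2 := eta2_pos hp hq
  have hI := profileIntegral_pos hp hq hm
  have hK := sharpConst_pos hp hq hm
  have hη : eta1 p m = eta2 p q + (p - 1) * (m - q) := sub_eq_iff_eq_add'.1 eta1_sub_eta2
  refine Real.log_injOn_pos (powConst_pos hp hq hm) (mem_Ioi.2 (by positivity)) ?_
  rw [Real.log_rpow hK, log_sharpConst hp hq hm, powConst,
    Real.log_mul (by positivity) (by positivity), Real.log_mul (by positivity) (by positivity),
    Real.log_div hη2.ne' hη1.ne', Real.log_rpow (by positivity), Real.log_rpow (by positivity),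
    Real.log_div (by positivity) hη1.ne', Real.log_mul hp1.ne' hmq.ne',
    Real.log_mul two_ne_zero hI.ne', ell_eq]
  generalize Real.log (eta1 p m) = logη1
  rw [hη]
  field_simp
  ring

lemma theta_eq : theta p q m = p * (m - q) / ((m + 1) * eta2 p q) := by
  unfold theta eta2
  congr 2
  ring

lemma theta_pos (hp : 1 < p) (hq : 0 < q + 1) (hm : q < m) : 0 < theta p q m := by
  rw [theta_eq]
  exact div_pos (mul_pos (by linarith) (by linarith)) (mul_pos (by linarith) (eta2_pos hp hq))

lemma one_sub_theta (hp : 1 < p) (hq : 0 < q + 1) (hm : q < m) :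
    1 - theta p q m = (q + 1) * eta1 p m / ((m + 1) * eta2 p q) := by
  have hden : (m + 1) * eta2 p q ≠ 0 := mul_ne_zero (by linarith) (eta2_pos hp hq).ne'
  rw [theta_eq, eq_div_iff hden, sub_mul, div_mul_cancel₀ _ hden]
  unfold eta1 eta2
  ring

lemma one_sub_theta_pos (hp : 1 < p) (hq : 0 < q + 1) (hm : q < m) : 0 < 1 - theta p q m := by
  have hm1 : 0 < m + 1 := by linarith
  rw [one_sub_theta hp hq hm]
  exact div_pos (mul_pos hq (eta1_pos hp hm1)) (mul_pos hm1 (eta2_pos hp hq))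

lemma theta_scaling (hp : 1 < p) (hq : 0 < q + 1) (hm : q < m) :
    1 / (m + 1) + theta p q m = (1 - theta p q m) / (q + 1) + theta p q m / p := by
  have hη2 := (eta2_pos hp hq).ne'
  have hm1 : m + 1 ≠ 0 := by linarith
  have hp0 : p ≠ 0 := by linarith
  rw [one_sub_theta hp hq hm, theta_eq]
  field_simp
  unfold eta1 eta2
  ring

lemma log_theta (hp : 1 < p) (hq : 0 < q + 1) (hm : q < m) : Real.log (theta p q m) =
    Real.log p + Real.log (m - q) - (Real.log (m + 1) + Real.log (eta2 p q)) := by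
  have hp0 : p ≠ 0 := by linarith
  have hmq : m - q ≠ 0 := (sub_pos.2 hm).ne'
  have hm1 : m + 1 ≠ 0 := by linarith
  have hη2 := (eta2_pos hp hq).ne'
  rw [theta_eq, Real.log_div (mul_ne_zero hp0 hmq) (mul_ne_zero hm1 hη2), Real.log_mul hp0 hmq,
    Real.log_mul hm1 hη2]

lemma log_one_sub_theta (hp : 1 < p) (hq : 0 < q + 1) (hm : q < m) : Real.log (1 - theta p q m) =
    Real.log (q + 1) + Real.log (eta1 p m) - (Real.log (m + 1) + Real.log (eta2 p q)) := by
  have hm1 : 0 < m + 1 := by linarith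
  have hη1 := (eta1_pos hp hm1).ne'
  have hη2 := (eta2_pos hp hq).ne'
  rw [one_sub_theta hp hq hm, Real.log_div (mul_ne_zero hq.ne' hη1) (mul_ne_zero hm1.ne' hη2),
    Real.log_mul hq.ne' hη1, Real.log_mul hm1.ne' hη2]

lemma massConst_pos (hp : 1 < p) (hq : 0 < q + 1) (hm : q < m) (hM : 0 < M) :
    0 < massConst p q m M := by
  have := theta_pos hp hq hm
  have := one_sub_theta_pos hp hq hm
  unfold massConst
  positivity

lemma log_massConst (hp : 1 < p) (hq : 0 < q + 1) (hm : q < m) (hM : 0 < M) :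
    Real.log (massConst p q m M) = -(theta p q m / p) * Real.log (theta p q m) +
      (theta p q m / p - 1 / (m + 1)) * Real.log (1 - theta p q m) +
        -theta p q m * Real.log M := by
  have hθ := theta_pos hp hq hm
  have hθ1 := one_sub_theta_pos hp hq hm
  rw [massConst, Real.log_mul (by positivity) (by positivity),
    Real.log_mul (by positivity) (by positivity), Real.log_rpow hθ, Real.log_rpow hθ1,
    Real.log_rpow hM]

-- The norms of the ground state are those of a function of mass `M` below, so `massConst` is its
-- Gagliardo–Nirenberg quotient.
lemma massConst_mul (hp : 1 < p) (hq : 0 < q + 1) (hm : q < m) (hM : 0 < M) :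
    massConst p q m M * (M ^ (1 / (q + 1))) ^ (1 - theta p q m) *
      ((theta p q m * M / (1 - theta p q m)) ^ (1 / p)) ^ theta p q m =
    (M / (1 - theta p q m)) ^ (1 / (m + 1)) := by
  have hθ := theta_pos hp hq hm
  have hθ1 := one_sub_theta_pos hp hq hm
  have hmass := massConst_pos hp hq hm hM
  refine Real.log_injOn_pos (mem_Ioi.2 (by positivity)) (mem_Ioi.2 (by positivity)) ?_
  rw [Real.log_mul (by positivity) (by positivity), Real.log_mul hmass.ne' (by positivity),
    Real.log_rpow (by positivity), Real.log_rpow hM, Real.log_rpow (by positivity),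
    Real.log_rpow (by positivity), Real.log_div (by positivity) hθ1.ne',
    Real.log_mul hθ.ne' hM.ne', Real.log_rpow (by positivity), Real.log_div hM.ne' hθ1.ne',
    log_massConst hp hq hm hM]
  linear_combination Real.log M * -theta_scaling hp hq hm

lemma log_peak (hq : 0 < q + 1) (hm : q < m) :
    Real.log (peak q m) = 1 / (m - q) * (Real.log (m + 1) - Real.log (q + 1)) := by
  have hm1 : 0 < m + 1 := by linarith
  rw [peak, Real.log_rpow (div_pos hm1 hq), Real.log_div hm1.ne' hq.ne']

end Constants

section ProfileNorms

variable {p q m : ℝ} {u : ℝ → ℝ}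

namespace IsProfile

lemma integral_abs_deriv_rpow_eq (h : IsProfile p q m u) (hp : 1 < p) (hq : 0 < q + 1)
    (hm : q < m) : ∫ r in Ioi 0, |deriv u r| ^ p = (p / (p - 1) / (m + 1)) ^ ((p - 1) / p) *
      (peak q m ^ (eta1 p m / p) * profileIntegral p q m) := by
  have hpeak := peak_pos hq hm
  have hm1 : 0 < m + 1 := by linarith
  have := conjExponent_pos hp
  rw [h.integral_abs_deriv_rpow hp hq hm, ← integral_rpow_sub_rpow hp hq hm hpeak,
    ← intervalIntegral.integral_const_mul]
  refine intervalIntegral.integral_congr fun s hs => ?_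
  rw [uIcc_of_le hpeak.le] at hs
  have hweight := sub_nonneg.2 (rpow_add_one_le hq hm hs.1 hs.2)
  have hpotential : potential q m s =
      (peak q m ^ (m - q) * s ^ (q + 1) - s ^ (m + 1)) / (m + 1) := by
    rw [peak_rpow hq hm, potential]
    field_simp
  have hnonneg : 0 ≤ potential q m s := hpotential ▸ div_nonneg hweight hm1.le
  rw [speed_rpow hp hnonneg, hpotential, mul_div_assoc', ← div_mul_eq_mul_div,
    Real.mul_rpow (by positivity) hweight]

lemma integral_rpow_add_one_eq (h : IsProfile p q m u) (hp : 1 < p) (hq : 0 < q + 1)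
    (hm : q < m) :
    ∫ r in Ioi 0, u r ^ (m + 1) = (∫ r in Ioi 0, u r ^ (q + 1)) / (1 - theta p q m) := by
  have henergy := h.integral_energy hp hq hm
  rw [h.integral_nehari hp hq hm] at henergy
  have hm1 : 0 < m + 1 := by linarith
  have hη1 := (eta1_pos hp hm1).ne'
  have := (eta2_pos hp hq).ne'
  have hp1 : p - 1 ≠ 0 := (sub_pos.2 hp).ne'
  rw [one_sub_theta hp hq hm]
  field_simp at henergy ⊢
  unfold eta1 eta2
  linear_combination henergy

lemma integral_abs_deriv_rpow_eq_mass (h : IsProfile p q m u) (hp : 1 < p) (hq : 0 < q + 1)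
    (hm : q < m) : ∫ r in Ioi 0, |deriv u r| ^ p =
      theta p q m * (∫ r in Ioi 0, u r ^ (q + 1)) / (1 - theta p q m) := by
  have := (one_sub_theta_pos hp hq hm).ne'
  rw [h.integral_nehari hp hq hm, h.integral_rpow_add_one_eq hp hq hm]
  field_simp
  ring

lemma mass_pos (h : IsProfile p q m u) (hp : 1 < p) (hq : 0 < q + 1) (hm : q < m) :
    0 < ∫ r in Ioi 0, u r ^ (q + 1) := by
  have hkinetic : 0 < theta p q m * (∫ r in Ioi 0, u r ^ (q + 1)) / (1 - theta p q m) := by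
    have := peak_pos hq hm
    have := profileIntegral_pos hp hq hm
    have := div_pos (conjExponent_pos hp) (show 0 < m + 1 by linarith)
    rw [← h.integral_abs_deriv_rpow_eq_mass hp hq hm, h.integral_abs_deriv_rpow_eq hp hq hm]
    positivity
  rw [div_pos_iff_of_pos_right (one_sub_theta_pos hp hq hm)] at hkinetic
  exact pos_of_mul_pos_right hkinetic (theta_pos hp hq hm).le

lemma log_mass (h : IsProfile p q m u) (hp : 1 < p) (hq : 0 < q + 1) (hm : q < m) :
    Real.log (∫ r in Ioi 0, u r ^ (q + 1)) =
      (p - 1) / p * (Real.log p - Real.log (p - 1) - Real.log (m + 1)) +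
        (eta1 p m / p * (1 / (m - q) * (Real.log (m + 1) - Real.log (q + 1))) +
          Real.log (profileIntegral p q m)) +
        Real.log (1 - theta p q m) - Real.log (theta p q m) := by
  have hp0 : 0 < p := by linarith
  have hp1 : 0 < p - 1 := sub_pos.2 hp
  have hm1 : 0 < m + 1 := by linarith
  have hI := profileIntegral_pos hp hq hm
  have hpeak := peak_pos hq hm
  have hmass := h.mass_pos hp hq hm
  have hθ := theta_pos hp hq hm
  have hkinetic := (h.integral_abs_deriv_rpow_eq hp hq hm).symm.trans
    (h.integral_abs_deriv_rpow_eq_mass hp hq hm)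
  replace hkinetic := congrArg Real.log hkinetic
  rw [Real.log_mul (by positivity) (by positivity), Real.log_rpow (by positivity),
    Real.log_div (by positivity) hm1.ne', Real.log_div hp0.ne' hp1.ne',
    Real.log_mul (by positivity) hI.ne', Real.log_rpow hpeak, log_peak hq hm,
    Real.log_div (by positivity) (one_sub_theta_pos hp hq hm).ne',
    Real.log_mul hθ.ne' hmass.ne'] at hkinetic
  linarith

lemma sharpConst_eq_massConst (h : IsProfile p q m u) (hp : 1 < p) (hq : 0 < q + 1)
    (hm : q < m) : sharpConst p q m = massConst p q m (∫ x, u |x| ^ (q + 1)) := by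
  have hmq : m - q ≠ 0 := (sub_pos.2 hm).ne'
  have hm1 : m + 1 ≠ 0 := by linarith
  have hη2 := (eta2_pos hp hq).ne'
  have hmass := h.mass_pos hp hq hm
  have hη : eta1 p m = eta2 p q + (p - 1) * (m - q) := sub_eq_iff_eq_add'.1 eta1_sub_eta2
  rw [integral_comp_abs (f := fun r => u r ^ (q + 1))]
  refine Real.log_injOn_pos (sharpConst_pos hp hq hm)
    (massConst_pos hp hq hm (mul_pos two_pos hmass)) ?_
  rw [log_sharpConst hp hq hm, log_massConst hp hq hm (mul_pos two_pos hmass),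
    Real.log_mul two_ne_zero hmass.ne', h.log_mass hp hq hm, log_theta hp hq hm,
    log_one_sub_theta hp hq hm, theta_eq, ell_eq]
  generalize Real.log (eta1 p m) = logη1
  generalize Real.log (eta2 p q) = logη2
  rw [hη]
  field_simp
  unfold eta2
  ring

end IsProfile

end ProfileNorms

section BestConstant

variable {p q m : ℝ}

lemma eLpNorm_ofReal_eq {α : Type*} [MeasurableSpace α] {μ : Measure α} {f : α → ℝ} {s : ℝ}
    (hs : 0 < s) (hf : MemLp f (ENNReal.ofReal s) μ) :
    eLpNorm f (ENNReal.ofReal s) μ = ENNReal.ofReal ((∫ x, |f x| ^ s ∂μ) ^ (1 / s)) := by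
  simp only [hf.eLpNorm_eq_integral_rpow_norm (ENNReal.ofReal_pos.2 hs).ne' ENNReal.ofReal_ne_top,
    ENNReal.toReal_ofReal hs.le, one_div, Real.norm_eq_abs]

lemma ofReal_mul_rpow_mul_rpow {a b c s t : ℝ} (ha : 0 ≤ a) (hb : 0 ≤ b) (hc : 0 ≤ c)
    (hs : 0 ≤ s) (ht : 0 ≤ t) :
    ENNReal.ofReal a * ENNReal.ofReal b ^ s * ENNReal.ofReal c ^ t =
      ENNReal.ofReal (a * b ^ s * c ^ t) := by
  rw [ENNReal.ofReal_rpow_of_nonneg hb hs, ENNReal.ofReal_rpow_of_nonneg hc ht,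
    ← ENNReal.ofReal_mul ha, ← ENNReal.ofReal_mul (by positivity)]

lemma IsLebesguePrimitive.rpow_integral_le {w g : ℝ → ℝ} (h : IsLebesguePrimitive w g)
    (hp : 1 < p) (hq : 0 < q + 1) (hm : q < m) (hgp : Integrable fun x => |g x| ^ p)
    (hw : Integrable fun x => |w x| ^ (q + 1)) :
    (∫ x, |w x| ^ (m + 1)) ^ (1 / (m + 1)) ≤ sharpConst p q m *
      ((∫ x, |w x| ^ (q + 1)) ^ (1 / (q + 1))) ^ (1 - theta p q m) *
        ((∫ x, |g x| ^ p) ^ (1 / p)) ^ theta p q m := by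
  have hp0 : p ≠ 0 := by linarith
  have hm1 : 0 < m + 1 := by linarith
  have hη2 := (eta2_pos hp hq).ne'
  have hK := sharpConst_pos hp hq hm
  have hA : 0 ≤ ∫ x, |w x| ^ (m + 1) := integral_nonneg fun x => by positivity
  have hB : 0 ≤ ∫ x, |w x| ^ (q + 1) := integral_nonneg fun x => by positivity
  have hP : 0 ≤ ∫ x, |g x| ^ p := integral_nonneg fun x => by positivity
  have hmassExponent : eta1 p m / eta2 p q * (1 / (m + 1)) =
      1 / (q + 1) * (1 - theta p q m) := by
    rw [one_sub_theta hp hq hm]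
    field_simp
  have hkineticExponent : (m - q) / eta2 p q * (1 / (m + 1)) = 1 / p * theta p q m := by
    rw [theta_eq]
    field_simp
  refine (Real.rpow_le_rpow hA (h.integral_rpow_add_one_le hp hq hm hgp hw)
    (one_div_pos.2 hm1).le).trans_eq ?_
  rw [powConst_eq hp hq hm, Real.mul_rpow (by positivity) (by positivity),
    Real.mul_rpow (by positivity) (by positivity), ← Real.rpow_mul hK.le, ← Real.rpow_mul hB,
    ← Real.rpow_mul hP, ← Real.rpow_mul hB, ← Real.rpow_mul hP, mul_one_div_cancel hm1.ne',
    Real.rpow_one, hmassExponent, hkineticExponent]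

lemma gnInequality_sharpConst (hp : 1 < p) (hq : 0 < q + 1) (hm : q < m) :
    GNInequality p q m (sharpConst p q m) := by
  rintro v g ⟨hv, hg, hvg⟩
  have hp0 : 0 < p := by linarith
  have hm1 : 0 < m + 1 := by linarith
  obtain ⟨w, hwg, hvw⟩ := hvg.exists_primitive
  have hw := hv.ae_eq hvw
  have hgp := (memLp_ofReal_iff hg.1 hp0).1 hg
  have hwq := (memLp_ofReal_iff hw.1 hq).1 hw
  obtain ⟨M, hM⟩ := hwg.exists_abs_le hp hq hgp hwq
  have hwm := (memLp_ofReal_iff hw.1 hm1).2 (hwg.integrable_abs_rpow_add_one hq hm hwq hM)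
  rw [eLpNorm_congr_ae hvw, eLpNorm_congr_ae hvw, eLpNorm_ofReal_eq hm1 hwm,
    eLpNorm_ofReal_eq hq hw, eLpNorm_ofReal_eq hp0 hg,
    ofReal_mul_rpow_mul_rpow (sharpConst_pos hp hq hm).le
      (Real.rpow_nonneg (integral_nonneg fun x => by positivity) _)
      (Real.rpow_nonneg (integral_nonneg fun x => by positivity) _)
      (one_sub_theta_pos hp hq hm).le (theta_pos hp hq hm).le]
  exact ENNReal.ofReal_le_ofReal (hwg.rpow_integral_le hp hq hm hgp hwq)

namespace IsProfile

variable {u : ℝ → ℝ}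

lemma integral_abs_comp_abs_rpow (h : IsProfile p q m u) (s : ℝ) :
    ∫ x, |u (|x|)| ^ s = 2 * ∫ r in Ioi 0, u r ^ s := by
  simp only [h.abs_comp_abs]
  exact integral_comp_abs (f := fun r => u r ^ s)

lemma integral_abs_deriv_comp_abs_rpow (h : IsProfile p q m u) :
    ∫ x, |deriv (fun x => u |x|) x| ^ p = 2 * ∫ r in Ioi 0, |deriv u r| ^ p := by
  rw [← integral_comp_abs (f := fun r => |deriv u r| ^ p)]
  exact (integral_congr_ae h.ae_abs_deriv_comp_abs).symm

lemma memLp_comp_abs (h : IsProfile p q m u) (hp : 1 < p) (hq : 0 < q + 1) (hm : q < m) :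
    MemLp (fun x => u |x|) (ENNReal.ofReal (m + 1)) := by
  rw [memLp_ofReal_iff (h.memX hp hq hm).1.1 (by linarith)]
  simp only [h.abs_comp_abs]
  exact integrable_comp_abs (f := fun r => u r ^ (m + 1)) (h.integrableOn_rpow_add_one hp hq hm)

lemma massConst_le (h : IsProfile p q m u) (hp : 1 < p) (hq : 0 < q + 1) (hm : q < m)
    {K : ℝ} (hK : 0 ≤ K) (hgn : GNInequality p q m K) :
    massConst p q m (∫ x, u |x| ^ (q + 1)) ≤ K := by
  have hp0 : 0 < p := by linarith
  have hm1 : 0 < m + 1 := by linarith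
  have hmem := h.memX hp hq hm
  have hθ := theta_pos hp hq hm
  have hθ1 := one_sub_theta_pos hp hq hm
  have hM : 0 < 2 * ∫ r in Ioi 0, u r ^ (q + 1) := mul_pos two_pos (h.mass_pos hp hq hm)
  have hquotient := hgn _ _ hmem
  rw [eLpNorm_ofReal_eq hm1 (h.memLp_comp_abs hp hq hm), eLpNorm_ofReal_eq hq hmem.1,
    eLpNorm_ofReal_eq hp0 hmem.2.1, h.integral_abs_comp_abs_rpow, h.integral_abs_comp_abs_rpow,
    h.integral_abs_deriv_comp_abs_rpow, h.integral_rpow_add_one_eq hp hq hm,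
    h.integral_abs_deriv_rpow_eq_mass hp hq hm, ← mul_div_assoc, ← mul_div_assoc,
    mul_left_comm 2 (theta p q m)] at hquotient
  rw [integral_comp_abs (f := fun r => u r ^ (q + 1))]
  set M := 2 * ∫ r in Ioi 0, u r ^ (q + 1)
  rw [ofReal_mul_rpow_mul_rpow hK (by positivity) (by positivity) hθ1.le hθ.le,
    ENNReal.ofReal_le_ofReal_iff (by positivity), ← massConst_mul hp hq hm hM,
    mul_assoc, mul_assoc] at hquotient
  exact le_of_mul_le_mul_right hquotient (by positivity)

end IsProfile

lemma isBestConstant_sharpConst (hp : 1 < p) (hqp : p - 1 ≤ q) (hm : q < m) :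
    IsBestConstant p q m (sharpConst p q m) := by
  have hq : 0 < q + 1 := by linarith
  refine ⟨⟨(sharpConst_pos hp hq hm).le, gnInequality_sharpConst hp hq hm⟩, fun K hK => ?_⟩
  have h := isProfile_closedForm hp hqp hm
  rw [h.sharpConst_eq_massConst hp hq hm]
  exact h.massConst_le hp hq hm hK.1 hK.2

end BestConstant

end GNOneDim

theorem theorem7p1 (p q : ℝ) (hp : 1 < p) (hq : p - 1 ≤ q) :
    (∀ m : ℝ, q < m →
      -- `B(·; 1 - 1/p, (p-1-q)/(p(m-q)))` is a bijection of `[0,1)` onto `[0,∞)`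
      BijOn (fun x => GNOneDim.incBeta x (1 - 1 / p) ((p - 1 - q) / (p * (m - q))))
        (Ico 0 1) (Ici 0) ∧
      -- existence, uniqueness and closed form of the ground state
      (∀ u : ℝ → ℝ, GNOneDim.IsPositiveSolution p q m u ↔
        ∀ r : ℝ, 0 ≤ r → u r = GNOneDim.closedForm p q m r) ∧
      -- the ground state is decreasing, and its even extension has the integrability of the
      -- admissible class
      (∀ u : ℝ → ℝ, GNOneDim.IsPositiveSolution p q m u →
        (∀ r : ℝ, 0 < r → deriv u r < 0) ∧
        ∃ g : ℝ → ℝ, GNOneDim.MemX p q (fun x => u |x|) g) ∧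
      -- the best constant
      GNOneDim.IsBestConstant p q m (GNOneDim.sharpConst p q m) ∧
      (∀ u : ℝ → ℝ, GNOneDim.IsPositiveSolution p q m u →
        GNOneDim.sharpConst p q m =
          GNOneDim.massConst p q m (∫ x : ℝ, u |x| ^ (q + 1)))) ∧
    -- decay estimates, with `r_*` and `C` independent of `m`
    (∃ rstar : ℝ, 0 < rstar ∧
      (p - 1 < q → ∃ C : ℝ, 0 < C ∧ ∀ m : ℝ, 2 * q + 1 < m →
        ∀ u : ℝ → ℝ, GNOneDim.IsPositiveSolution p q m u → ∀ r : ℝ, 2 * rstar ≤ r →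
          u r + r * |deriv u r| ≤ C * r ^ (-(p / (q + 1 - p)))) ∧
      (q = p - 1 → ∃ C : ℝ, 0 < C ∧ ∀ m : ℝ, 2 * q + 1 < m →
        ∀ u : ℝ → ℝ, GNOneDim.IsPositiveSolution p q m u → ∀ r : ℝ, 2 * rstar ≤ r →
          u r ≤ Real.exp (-(C * r)))) := by
  have hq0 : 0 < q + 1 := by linarith
  refine ⟨fun m hm => ?_, GNOneDim.unitRadius p q, GNOneDim.unitRadius_pos hp hq0, fun hpq => ?_,
    fun hpq => ?_⟩
  · obtain ⟨ha, ha1⟩ := GNOneDim.one_sub_one_div_mem hp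
    have hb := GNOneDim.closedForm_exponent_nonpos (by linarith) hq hm.le
    exact ⟨GNOneDim.bijOn_incBeta ha ha1.le hb, GNOneDim.isPositiveSolution_iff hp hq hm,
      fun u hu => ⟨fun r hr => hu.deriv_neg hp hq0 hm hr, _,
        (hu.isProfile hp hq0 hm).memX hp hq0 hm⟩,
      GNOneDim.isBestConstant_sharpConst hp hq hm,
      fun u hu => (hu.isProfile hp hq0 hm).sharpConst_eq_massConst hp hq0 hm⟩
  · exact ⟨GNOneDim.decayConst p q, GNOneDim.decayConst_pos hp hpq, fun m hm u hu r hr =>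
      (hu.isProfile hp hq0 (by linarith)).algebraic_decay hp hpq hm hr⟩
  · exact ⟨GNOneDim.decayRate p q / 2, half_pos (GNOneDim.decayRate_pos hp hq0),
      fun m hm u hu r hr => (hu.isProfile hp hq0 (by linarith)).exp_decay hp hpq hm hr⟩
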